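/- **Setting.** Let $\Phi_s,\Phi_m$ be finite CNF formulas (finite sets of clauses, a clause being a finite set of literals), and let $I$ be a finite set of *interface* variables containing every variable common to both. The *secondary* solver $S_s$ has the variables $W_s=\mathrm{vars}(\Phi_s)\cup I$, the *main* solver $S_m$ the variables $W_m=\mathrm{vars}(\Phi_m)\cup I$. A literal or clause is *shared* if all its variables are in $I$. Each solver has a search mode, a conflict clause (or none), a clause database and a trail. A trail is a sequence of decisions $\ell$, null literals $\dagger$, propagated literals $\ell^{C}$ with reason clause $C$, and literals $\ell^{\bot}$ with external reason; decisions and $\dagger$ open a new decision level. $M^k$ is the part of $M$ at levels $\le k$. A clause is *false* under $M$ if all its literals are; it is *unit* (with literal $\ell$) under $M$ if $\ell$ is unassigned and all its other literals are false; it is *asserting at level* $k$ if it is unit under $M^k$; its *backjump level* is the least such $k$. $M_x$ is a *full satisfying assignment* if it assigns all of $W_x$ and makes every clause of the database of $S_x$ true. $\mathrm{AnalyzeFinal}(\ell)$ succeeds in a solver if $\ell$ has a reason clause on its trail from which, by zero or more resolutions with reason clauses on that trail, a shared clause $c$ is obtained; any such $c$ may be returned. **The transition system SpecSMS.** Modes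 are $P$, $D^i$, $D^{i,j}$, $F$. States are written $\langle\text{mode of }S_s,\text{mode of }S_m\rangle$; there is one further state *unsat*. The start is $\langle P,D^0\rangle$ with databases $\Phi_s,\Phi_m$, no conflict and empty trails. "Back-jump" applies to both trails. At most one solver at a time has a conflict clause; rules below that do not mention a conflict clause need both solvers to have none, and those that mention one need the other solver to have none. Rules (applied nondeterministically): 1. *Propagate* (either solver). If a clause $C$ of its database is unit with literal $\ell$, append $\ell^{C}$. If $\ell$ is shared, the other trail is extended at the same time: by $\ell^{E}$ for a shared clause $E$ of the first solver's database that is unit with literal $\ell$ under the other trail, or by $\ell^\bot$ if there is no such $E$. 2. *Conflict* (either solver). A false clause of its database becomes its conflict clause. 3. *Explain* (either solver). Resolve the conflict clause $\neg\ell\vee C$ with the reason of an $\ell^{\ell\vee D}$ on its own trail. 4. *Reason* (either solver). If the conflict clause contains $\neg\ell$, where $\ell^\bot$ is on its own trail, and $\mathrm{AnalyzeFinal}(\ell)$ in the other solver returns $c$, add $c$ to the own database and make it the reason of $\ell$. 5. *Decide*. If no clause of either database is unit under the trail of its solver, a solver in mode $D^i$ or $D^{i,j}$ decides an unassigned literal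 $\ell$ over one of its variables; the other trail gets $\dagger$, followed by $\ell^\bot$ if $\ell$ is shared. For $S_s$ this requires mode $D^i$ with $S_m$ in $P$ or $F$, and in $P$ if $\ell$ is shared. 6. *Speculate*. $\langle P,D^0\rangle\to\langle D^i,P\rangle$, $i$ the current level, if no clause is unit in either solver. 7. *Finish*. If $M_m$ is a full satisfying assignment: $\langle P,D^0\rangle\to\langle D^i,F\rangle$, $i$ the current level, and $\langle F,D^{i,j}\rangle\to\langle F,F\rangle$. If $M_s$ is one: $\langle D^i,P\rangle\to\langle F,D^{i,j}\rangle$ (*validation*), $j$ the current level, and $\langle D^i,F\rangle\to\langle F,F\rangle$. 8. *Learn*. A conflict clause not yet in the database may be added to it: to the own database of a solver in a mode $D^i$ or $D^{i,j}$; if it is shared, from $S_s$ to $S_m$, and from $S_m$ to $S_s$ in $\langle D^i,P\rangle$. 9. *Pass*. A shared conflict clause already in the receiver's database moves from $S_s$ to $S_m$ in $\langle P,D^0\rangle$, and from $S_m$ to $S_s$ in $\langle D^i,P\rangle$ and $\langle D^i,F\rangle$. 10. *Backjump*. Let the conflict clause $C$ of the solver named below be in its database, with backjump level $d$. Then the conflict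 is cleared and both solvers back-jump to level $k$, where $C$ must be asserting: $k=d$ for $S_m$ in $\langle P,D^0\rangle$; $k=\max(d,i)$ for $S_s$ in $\langle D^i,P\rangle$ or $\langle D^i,F\rangle$; $k=\max(d,j)$ for $S_m$ in $\langle F,D^{i,j}\rangle$ if $d\ge i$; and, if $d<i$ in $\langle F,D^{i,j}\rangle$, $k=d$ with transition to $\langle P,D^0\rangle$. *Backtrack*: in the first three cases (in the third one without the condition on $d$), $k$ may also be the current level minus one, if $C$ is asserting there and $k\ge 0,i,j$, respectively. 11. *Exit*. If, in $\langle D^i,P\rangle$ or $\langle D^i,F\rangle$, $S_s$ has a shared conflict clause that is in the database of $S_m$ and false under $M_s^i$, or if, in $\langle D^i,P\rangle$, $S_m$ has a conflict clause that is false under $M_m^i$: back-jump to level $i$, go to $\langle P,D^0\rangle$, and the clause becomes the conflict clause of $S_m$ (alone). 12. *Refine*. Back-jump to level $i$, clear the conflict, go to $\langle P,D^0\rangle$, and $S_m$ decides the variable of $\ell$ with either sign (with $\dagger$ and the decided literal with external reason appended to $M_s$), where $\ell$ is unassigned in $M_m^i$ and one of the following holds. (a) In $\langle D^i,P\rangle$,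 the conflict clause of $S_s$ contains $\neg\ell$, $\ell^\bot$ is on $M_s$, and $\mathrm{AnalyzeFinal}(\ell)$ fails in $S_m$. (b) In $\langle F,D^{i,j}\rangle$, the same with $S_s$ and $S_m$ exchanged. (c) In $\langle D^i,P\rangle$, the conflict clause of $S_m$ contains the negation of a non-shared decision of $S_m$, and $\ell$ is a shared literal on $M_s$. 13. *Fail*. If the conflict clause of $S_m$ is false under $M_m^0$, go to *unsat*. If, in $\langle D^i,P\rangle$, that of $S_s$ is false under $M_s^0$, back-jump to level $i$, go to $\langle P,D^0\rangle$, clear the conflict of $S_s$, add the empty clause to the database of $S_m$ and make it the conflict clause of $S_m$. **Theorem.** SpecSMS terminates: from the initial configuration there is no infinite run, and every reachable configuration without a successor is in state $\langle F,F\rangle$ or *unsat*. If SpecSMS reaches $\langle F,F\rangle$, then $\Phi_s\wedge\Phi_m$ is satisfiable, and the join of the trails of $S_s$ and $S_m$ (the union of their sets of literals) is a satisfying assignment: it is consistent, assigns every variable of $\Phi_s\wedge\Phi_m$ and makes every clause true. If SpecSMS reaches *unsat*, then $\Phi_s\wedge\Phi_m$ is unsatisfiable. -/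

import Mathlib

namespace SpecSMS

/-! ### Propositional logic -/

/-- A literal: a variable with a sign (`true` for the positive literal). -/
abbrev Lit (V : Type*) := V × Bool

/-- The complementary literal. -/
def neg {V : Type*} (l : Lit V) : Lit V := (l.1, !l.2)

/-- A clause is a finite set of literals, read as their disjunction. -/
abbrev Clause (V : Type*) := Finset (Lit V)

/-- A CNF formula (or clause database) is a finite set of clauses. -/
abbrev Formula (V : Type*) := Finset (Clause V)

/-- The variables occurring in a formula. -/
def vars {V : Type*} [DecidableEq V] (Φ : Formula V) : Finset V :=
  Φ.biUnion fun C => C.image Prod.fst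

def Satisfiable {V : Type*} (Φ : Formula V) : Prop :=
  ∃ a : V → Bool, ∀ C ∈ Φ, ∃ l ∈ C, a l.1 = l.2

/-- The set of literals `L`, read as a partial assignment, is a satisfying assignment of `Φ`:
it is consistent, assigns every variable of `Φ`, and makes every clause of `Φ` true. -/
def IsSatisfyingAssignment {V : Type*} [DecidableEq V] (L : Set (Lit V)) (Φ : Formula V) : Prop :=
  (∀ l ∈ L, neg l ∉ L) ∧ (∀ v ∈ vars Φ, ∃ b, (v, b) ∈ L) ∧ ∀ C ∈ Φ, ∃ l ∈ C, l ∈ L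

/-- All variables of the clause are interface variables. -/
def Shared {V : Type*} (I : Finset V) (C : Clause V) : Prop := ∀ l ∈ C, l.1 ∈ I

/-- The resolvent of a clause `C` containing `neg l` with a clause `R` containing `l`. -/
def resolvent {V : Type*} [DecidableEq V] (l : Lit V) (C R : Clause V) : Clause V :=
  C.erase (neg l) ∪ R.erase l

/-! ### Trails -/

/-- Trail entries: a decision, a null literal (it opens a decision level without assigning a
variable), a literal propagated with a reason clause, or a literal whose justification is
external, i.e. is found in the other solver. -/
inductive Entry (V : Type*) where
  | decision (l : Lit V)
  | null
  | prop (l : Lit V) (reason : Clause V)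
  | ext (l : Lit V)

/-- The literal of a trail entry. -/
def Entry.lit? {V : Type*} : Entry V → Option (Lit V)
  | .decision l => some l
  | .null => none
  | .prop l _ => some l
  | .ext l => some l

/-- Does the entry open a new decision level? -/
def Entry.opensLevel {V : Type*} : Entry V → Bool
  | .decision _ => true
  | .null => true
  | _ => false

/-- A trail, with the MOST RECENT entry at the head of the list. -/
abbrev Trail (V : Type*) := List (Entry V)

/-- The literals made true by a trail. -/
def lits {V : Type*} (M : Trail V) : Set (Lit V) := {l | ∃ e ∈ M, e.lit? = some l}

/-- The current decision level of a trail. -/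
def level {V : Type*} (M : Trail V) : ℕ := M.countP Entry.opensLevel

/-- The part of the trail at decision levels at most `k`. -/
def upTo {V : Type*} (k : ℕ) : Trail V → Trail V
  | [] => []
  | e :: M => if level (e :: M) ≤ k then e :: M else upTo k M

def Unassigned {V : Type*} (M : Trail V) (l : Lit V) : Prop := l ∉ lits M ∧ neg l ∉ lits M

/-- All literals of `C` are false under `M`. -/
def Falsified {V : Type*} (M : Trail V) (C : Clause V) : Prop := ∀ l ∈ C, neg l ∈ lits M

/-- `C` is unit under `M`, and `l` is its only literal that is not false. -/
def UnitUnder {V : Type*} (M : Trail V) (C : Clause V) (l : Lit V) : Prop :=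
  l ∈ C ∧ Unassigned M l ∧ ∀ x ∈ C, x ≠ l → neg x ∈ lits M

/-- No clause of `Φ` is unit under `M`. -/
def NoUnit {V : Type*} (M : Trail V) (Φ : Formula V) : Prop := ∀ C ∈ Φ, ∀ l, ¬ UnitUnder M C l

/-- `C` is asserting at level `k`: it is unit after back-jumping to level `k`. -/
def AssertingAt {V : Type*} (M : Trail V) (C : Clause V) (k : ℕ) : Prop :=
  ∃ l, UnitUnder (upTo k M) C l

/-- `k` is the smallest level at which `C` is asserting. For a clause that is false under `M`
and has exactly one literal of the highest level, this is the second highest level in `C`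
(and `0` for a clause with one literal). -/
def IsBackjumpLevel {V : Type*} (M : Trail V) (C : Clause V) (k : ℕ) : Prop :=
  IsLeast {k | AssertingAt M C k} k

/-- `M` is a full satisfying assignment to the clauses `Φ` of a solver with variables `W`. -/
def FullSat {V : Type*} (W : Finset V) (M : Trail V) (Φ : Formula V) : Prop :=
  (∀ v ∈ W, ∃ b, (v, b) ∈ lits M) ∧ ∀ C ∈ Φ, ∃ l ∈ C, l ∈ lits M

/-- Clauses obtained from `C` by repeatedly resolving with reason clauses on the trail `M`. -/
inductive Resolves {V : Type*} [DecidableEq V] (M : Trail V) (C : Clause V) : Clause V → Prop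
  | refl : Resolves M C C
  | step {D R : Clause V} {l : Lit V} : Resolves M C D → neg l ∈ D → Entry.prop l R ∈ M →
      Resolves M C (resolvent l D R)

/-- A successful outcome of the final analysis of the literal `l` in the solver with trail `M`:
a clause `c` over the interface variables, of the form "interface literals imply `l`", obtained
from the reason clause of `l` by resolution with reason clauses. -/
def AnalyzeFinal {V : Type*} [DecidableEq V] (I : Finset V) (M : Trail V) (l : Lit V)
    (c : Clause V) : Prop :=
  Shared I c ∧ ∃ R, Entry.prop l R ∈ M ∧ Resolves M R c

open Classical in
/-- Replace the external justification of `l` by the reason clause `c`. -/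
noncomputable def setReason {V : Type*} (l : Lit V) (c : Clause V) (M : Trail V) : Trail V :=
  M.map fun e => if e = Entry.ext l then Entry.prop l c else e

/-! ### Configurations -/

/-- Search modes: `P` (propagate), `D i` (decide, levels up to `i` being assumptions),
`DV i j` (the decide mode of the main solver during validation, where `i` is the level at which
speculation started and `j` the level at which the secondary solver finished), and `F`
(finished). -/
inductive Mode where
  | P
  | D (i : ℕ)
  | DV (i j : ℕ)
  | F

/-- The solver may make decisions. -/
def Mode.Deciding : Mode → Prop
  | .D _ => True
  | .DV _ _ => True
  | _ => False

/-- Search mode, conflict clause (if any), clause database, and trail of a solver. -/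
structure Solver (V : Type*) where
  mode : Mode
  conf : Option (Clause V)
  db : Formula V
  trail : Trail V

/-- A configuration consists of the secondary solver `s` and the main solver `m`, or is the
state `unsat`. -/
inductive Config (V : Type*) where
  | run (s m : Solver V)
  | unsat

/-- The initial configuration, in state `⟨P, D⁰⟩` with empty trails. -/
def initial {V : Type*} (Φs Φm : Formula V) : Config V :=
  .run ⟨.P, none, Φs, []⟩ ⟨.D 0, none, Φm, []⟩

/-- The two final states, `⟨F, F⟩` and `unsat`. -/
def Config.IsFinal {V : Type*} : Config V → Prop
  | .run s m => s.mode = .F ∧ m.mode = .F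
  | .unsat => True

/-! ### Transitions -/

/-- Rules that do not depend on the search modes and may be taken by either solver: unit
propagation within and between solvers, and conflict analysis. `SymStep I a b a' b'`: the solver
`a` acts, `b` is the other solver, and they become `a'` and `b'`. -/
inductive SymStep {V : Type*} [DecidableEq V] (I : Finset V) :
    Solver V → Solver V → Solver V → Solver V → Prop
  /-- Propagation of a literal that is not shared. -/
  | prop {α β Φ Ψ M N C l} (hC : C ∈ Φ) (hu : UnitUnder M C l) (hl : l.1 ∉ I) :
      SymStep I ⟨α, none, Φ, M⟩ ⟨β, none, Ψ, N⟩
        ⟨α, none, Φ, .prop l C :: M⟩ ⟨β, none, Ψ, N⟩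
  /-- Propagation of a shared literal, which is copied to the other solver together with an
  interface clause that propagates it there. -/
  | propS {α β Φ Ψ M N C E l} (hC : C ∈ Φ) (hu : UnitUnder M C l) (hl : l.1 ∈ I)
      (hE : E ∈ Φ) (hEI : Shared I E) (hEu : UnitUnder N E l) :
      SymStep I ⟨α, none, Φ, M⟩ ⟨β, none, Ψ, N⟩
        ⟨α, none, Φ, .prop l C :: M⟩ ⟨β, none, Ψ, .prop l E :: N⟩
  /-- Propagation of a shared literal, which is copied to the other solver with an external
  justification, there being no interface clause that propagates it there. -/
  | propD {α β Φ Ψ M N C l} (hC : C ∈ Φ) (hu : UnitUnder M C l) (hl : l.1 ∈ I)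
      (hE : ¬ ∃ E ∈ Φ, Shared I E ∧ UnitUnder N E l) :
      SymStep I ⟨α, none, Φ, M⟩ ⟨β, none, Ψ, N⟩
        ⟨α, none, Φ, .prop l C :: M⟩ ⟨β, none, Ψ, .ext l :: N⟩
  /-- A clause is false under the trail. -/
  | conflict {α β Φ Ψ M N C} (hC : C ∈ Φ) (hf : Falsified M C) :
      SymStep I ⟨α, none, Φ, M⟩ ⟨β, none, Ψ, N⟩ ⟨α, some C, Φ, M⟩ ⟨β, none, Ψ, N⟩
  /-- Resolution of the conflict clause with the reason clause of one of its literals. -/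
  | explain {α β Φ Ψ M N C R l} (hC : neg l ∈ C) (hR : .prop l R ∈ M) :
      SymStep I ⟨α, some C, Φ, M⟩ ⟨β, none, Ψ, N⟩
        ⟨α, some (resolvent l C R), Φ, M⟩ ⟨β, none, Ψ, N⟩
  /-- The reason for an external literal in the conflict is obtained from the other solver; the
  interface clause is added to the clause database. -/
  | reason {α β Φ Ψ M N C c l} (hC : neg l ∈ C) (hl : .ext l ∈ M)
      (hc : AnalyzeFinal I N l c) :
      SymStep I ⟨α, some C, Φ, M⟩ ⟨β, none, Ψ, N⟩
        ⟨α, some C, insert c Φ, setReason l c M⟩ ⟨β, none, Ψ, N⟩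

/-- The transition relation. `I` is the set of interface variables, `Ws` and `Wm` are the
variables of the secondary and of the main solver. The state names below list the secondary
solver first: `⟨P, D⁰⟩` is normal execution, `⟨Dⁱ, P⟩` speculation, `⟨Dⁱ, F⟩` the state in which
the main solver has finished first, and `⟨F, Dⁱʲ⟩` validation. -/
inductive Step {V : Type*} [DecidableEq V] (I Ws Wm : Finset V) : Config V → Config V → Prop
  | sym_s {s m s' m'} (h : SymStep I s m s' m') : Step I Ws Wm (.run s m) (.run s' m')
  | sym_m {s m s' m'} (h : SymStep I m s m' s') : Step I Ws Wm (.run s m) (.run s' m')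
  -- decisions: only after exhaustive propagation
  | decide_m {α μ Φs Ms Φm Mm l} (hμ : μ.Deciding) (hs : NoUnit Ms Φs) (hm : NoUnit Mm Φm)
      (hl : l.1 ∈ Wm) (hI : l.1 ∉ I) (hu : Unassigned Mm l) :
      Step I Ws Wm (.run ⟨α, none, Φs, Ms⟩ ⟨μ, none, Φm, Mm⟩)
        (.run ⟨α, none, Φs, .null :: Ms⟩ ⟨μ, none, Φm, .decision l :: Mm⟩)
  | decide_mS {α μ Φs Ms Φm Mm l} (hμ : μ.Deciding) (hs : NoUnit Ms Φs) (hm : NoUnit Mm Φm)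
      (hl : l.1 ∈ Wm) (hI : l.1 ∈ I) (hu : Unassigned Mm l) :
      Step I Ws Wm (.run ⟨α, none, Φs, Ms⟩ ⟨μ, none, Φm, Mm⟩)
        (.run ⟨α, none, Φs, .ext l :: .null :: Ms⟩ ⟨μ, none, Φm, .decision l :: Mm⟩)
  | decide_s {i μ Φs Ms Φm Mm l} (hμ : μ = .P ∨ μ = .F) (hs : NoUnit Ms Φs) (hm : NoUnit Mm Φm)
      (hl : l.1 ∈ Ws) (hI : l.1 ∉ I) (hu : Unassigned Ms l) :
      Step I Ws Wm (.run ⟨.D i, none, Φs, Ms⟩ ⟨μ, none, Φm, Mm⟩)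
        (.run ⟨.D i, none, Φs, .decision l :: Ms⟩ ⟨μ, none, Φm, .null :: Mm⟩)
  | decide_sS {i Φs Ms Φm Mm l} (hs : NoUnit Ms Φs) (hm : NoUnit Mm Φm)
      (hl : l.1 ∈ Ws) (hI : l.1 ∈ I) (hu : Unassigned Ms l) :
      Step I Ws Wm (.run ⟨.D i, none, Φs, Ms⟩ ⟨.P, none, Φm, Mm⟩)
        (.run ⟨.D i, none, Φs, .decision l :: Ms⟩ ⟨.P, none, Φm, .ext l :: .null :: Mm⟩)
  -- starting speculation
  | speculate {Φs Ms Φm Mm} (hs : NoUnit Ms Φs) (hm : NoUnit Mm Φm) :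
      Step I Ws Wm (.run ⟨.P, none, Φs, Ms⟩ ⟨.D 0, none, Φm, Mm⟩)
        (.run ⟨.D (level Mm), none, Φs, Ms⟩ ⟨.P, none, Φm, Mm⟩)
  -- a solver has found a full satisfying assignment
  | fa_m {Φs Ms Φm Mm} (hf : FullSat Wm Mm Φm) :
      Step I Ws Wm (.run ⟨.P, none, Φs, Ms⟩ ⟨.D 0, none, Φm, Mm⟩)
        (.run ⟨.D (level Mm), none, Φs, Ms⟩ ⟨.F, none, Φm, Mm⟩)
  | fa_s_validate {i Φs Ms Φm Mm} (hf : FullSat Ws Ms Φs) :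
      Step I Ws Wm (.run ⟨.D i, none, Φs, Ms⟩ ⟨.P, none, Φm, Mm⟩)
        (.run ⟨.F, none, Φs, Ms⟩ ⟨.DV i (level Ms), none, Φm, Mm⟩)
  | fa_s_final {i Φs Ms Φm Mm} (hf : FullSat Ws Ms Φs) :
      Step I Ws Wm (.run ⟨.D i, none, Φs, Ms⟩ ⟨.F, none, Φm, Mm⟩)
        (.run ⟨.F, none, Φs, Ms⟩ ⟨.F, none, Φm, Mm⟩)
  | fa_validated {i j Φs Ms Φm Mm} (hf : FullSat Wm Mm Φm) :
      Step I Ws Wm (.run ⟨.F, none, Φs, Ms⟩ ⟨.DV i j, none, Φm, Mm⟩)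
        (.run ⟨.F, none, Φs, Ms⟩ ⟨.F, none, Φm, Mm⟩)
  -- learning a conflict clause, in the own solver or in the other one
  | learn_m {α μ C Φs Ms Φm Mm} (hμ : μ.Deciding) (hC : C ∉ Φm) :
      Step I Ws Wm (.run ⟨α, none, Φs, Ms⟩ ⟨μ, some C, Φm, Mm⟩)
        (.run ⟨α, none, Φs, Ms⟩ ⟨μ, some C, insert C Φm, Mm⟩)
  | learn_s {i μ C Φs Ms Φm Mm} (hC : C ∉ Φs) :
      Step I Ws Wm (.run ⟨.D i, some C, Φs, Ms⟩ ⟨μ, none, Φm, Mm⟩)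
        (.run ⟨.D i, some C, insert C Φs, Ms⟩ ⟨μ, none, Φm, Mm⟩)
  | learn_ms {α μ C Φs Ms Φm Mm} (hI : Shared I C) (hC : C ∉ Φm) :
      Step I Ws Wm (.run ⟨α, some C, Φs, Ms⟩ ⟨μ, none, Φm, Mm⟩)
        (.run ⟨α, some C, Φs, Ms⟩ ⟨μ, none, insert C Φm, Mm⟩)
  | learn_sm {i C Φs Ms Φm Mm} (hI : Shared I C) (hC : C ∉ Φs) :
      Step I Ws Wm (.run ⟨.D i, none, Φs, Ms⟩ ⟨.P, some C, Φm, Mm⟩)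
        (.run ⟨.D i, none, insert C Φs, Ms⟩ ⟨.P, some C, Φm, Mm⟩)
  -- passing a shared conflict clause to the active solver
  | explain_ms {C Φs Ms Φm Mm} (hI : Shared I C) (hC : C ∈ Φm) :
      Step I Ws Wm (.run ⟨.P, some C, Φs, Ms⟩ ⟨.D 0, none, Φm, Mm⟩)
        (.run ⟨.P, none, Φs, Ms⟩ ⟨.D 0, some C, Φm, Mm⟩)
  | explain_sm {i μ C Φs Ms Φm Mm} (hμ : μ = .P ∨ μ = .F) (hI : Shared I C) (hC : C ∈ Φs) :
      Step I Ws Wm (.run ⟨.D i, none, Φs, Ms⟩ ⟨μ, some C, Φm, Mm⟩)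
        (.run ⟨.D i, some C, Φs, Ms⟩ ⟨μ, none, Φm, Mm⟩)
  -- back-jumping and backtracking on an asserting clause
  | backjump_m {C k Φs Ms Φm Mm} (hC : C ∈ Φm) (hk : IsBackjumpLevel Mm C k) :
      Step I Ws Wm (.run ⟨.P, none, Φs, Ms⟩ ⟨.D 0, some C, Φm, Mm⟩)
        (.run ⟨.P, none, Φs, upTo k Ms⟩ ⟨.D 0, none, Φm, upTo k Mm⟩)
  | backtrack_m {C k Φs Ms Φm Mm} (hC : C ∈ Φm) (hk : level Mm = k + 1)
      (ha : AssertingAt Mm C k) :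
      Step I Ws Wm (.run ⟨.P, none, Φs, Ms⟩ ⟨.D 0, some C, Φm, Mm⟩)
        (.run ⟨.P, none, Φs, upTo k Ms⟩ ⟨.D 0, none, Φm, upTo k Mm⟩)
  | backjump_s {i μ C d k Φs Ms Φm Mm} (hμ : μ = .P ∨ μ = .F) (hC : C ∈ Φs)
      (hd : IsBackjumpLevel Ms C d) (hk : k = max d i) (ha : AssertingAt Ms C k) :
      Step I Ws Wm (.run ⟨.D i, some C, Φs, Ms⟩ ⟨μ, none, Φm, Mm⟩)
        (.run ⟨.D i, none, Φs, upTo k Ms⟩ ⟨μ, none, Φm, upTo k Mm⟩)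
  | backtrack_s {i μ C k Φs Ms Φm Mm} (hμ : μ = .P ∨ μ = .F) (hC : C ∈ Φs)
      (hk : level Ms = k + 1) (hi : i ≤ k) (ha : AssertingAt Ms C k) :
      Step I Ws Wm (.run ⟨.D i, some C, Φs, Ms⟩ ⟨μ, none, Φm, Mm⟩)
        (.run ⟨.D i, none, Φs, upTo k Ms⟩ ⟨μ, none, Φm, upTo k Mm⟩)
  | backjumpV_m {i j C d k Φs Ms Φm Mm} (hC : C ∈ Φm) (hd : IsBackjumpLevel Mm C d)
      (hi : i ≤ d) (hk : k = max j d) (ha : AssertingAt Mm C k) :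
      Step I Ws Wm (.run ⟨.F, none, Φs, Ms⟩ ⟨.DV i j, some C, Φm, Mm⟩)
        (.run ⟨.F, none, Φs, upTo k Ms⟩ ⟨.DV i j, none, Φm, upTo k Mm⟩)
  | backtrackV_m {i j C k Φs Ms Φm Mm} (hC : C ∈ Φm) (hk : level Mm = k + 1) (hj : j ≤ k)
      (ha : AssertingAt Mm C k) :
      Step I Ws Wm (.run ⟨.F, none, Φs, Ms⟩ ⟨.DV i j, some C, Φm, Mm⟩)
        (.run ⟨.F, none, Φs, upTo k Ms⟩ ⟨.DV i j, none, Φm, upTo k Mm⟩)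
  | backjumpVE_m {i j C k Φs Ms Φm Mm} (hC : C ∈ Φm) (hk : IsBackjumpLevel Mm C k)
      (hi : k < i) :
      Step I Ws Wm (.run ⟨.F, none, Φs, Ms⟩ ⟨.DV i j, some C, Φm, Mm⟩)
        (.run ⟨.P, none, Φs, upTo k Ms⟩ ⟨.D 0, none, Φm, upTo k Mm⟩)
  -- a conflict at or below the level at which the secondary solver started to decide:
  -- the main solver becomes active and continues the conflict analysis
  | exit_s {i μ C Φs Ms Φm Mm} (hμ : μ = .P ∨ μ = .F) (hI : Shared I C) (hC : C ∈ Φm)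
      (hf : Falsified (upTo i Ms) C) :
      Step I Ws Wm (.run ⟨.D i, some C, Φs, Ms⟩ ⟨μ, none, Φm, Mm⟩)
        (.run ⟨.P, none, Φs, upTo i Ms⟩ ⟨.D 0, some C, Φm, upTo i Mm⟩)
  | exit_m {i C Φs Ms Φm Mm} (hf : Falsified (upTo i Mm) C) :
      Step I Ws Wm (.run ⟨.D i, none, Φs, Ms⟩ ⟨.P, some C, Φm, Mm⟩)
        (.run ⟨.P, none, Φs, upTo i Ms⟩ ⟨.D 0, some C, Φm, upTo i Mm⟩)
  -- refinement: the conflict depends on local decisions of both solvers; the main solver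
  -- decides, at the level of the speculation, the variable of a literal responsible for this
  | refine_s {i C l r Φs Ms Φm Mm} (hC : neg l ∈ C) (hl : .ext l ∈ Ms)
      (hfail : ¬ ∃ c, AnalyzeFinal I Mm l c) (hu : Unassigned (upTo i Mm) l) (hr : r.1 = l.1) :
      Step I Ws Wm (.run ⟨.D i, some C, Φs, Ms⟩ ⟨.P, none, Φm, Mm⟩)
        (.run ⟨.P, none, Φs, .ext r :: .null :: upTo i Ms⟩
          ⟨.D 0, none, Φm, .decision r :: upTo i Mm⟩)
  | refine_sm {i C x l r Φs Ms Φm Mm} (hx : x ∈ C) (hxI : x.1 ∉ I)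
      (hxd : .decision (neg x) ∈ Mm) (hl : l ∈ lits Ms) (hI : l.1 ∈ I)
      (hu : Unassigned (upTo i Mm) l) (hr : r.1 = l.1) :
      Step I Ws Wm (.run ⟨.D i, none, Φs, Ms⟩ ⟨.P, some C, Φm, Mm⟩)
        (.run ⟨.P, none, Φs, .ext r :: .null :: upTo i Ms⟩
          ⟨.D 0, none, Φm, .decision r :: upTo i Mm⟩)
  | refine_m {i j C l r Φs Ms Φm Mm} (hC : neg l ∈ C) (hl : .ext l ∈ Mm)
      (hfail : ¬ ∃ c, AnalyzeFinal I Ms l c) (hu : Unassigned (upTo i Mm) l) (hr : r.1 = l.1) :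
      Step I Ws Wm (.run ⟨.F, none, Φs, Ms⟩ ⟨.DV i j, some C, Φm, Mm⟩)
        (.run ⟨.P, none, Φs, .ext r :: .null :: upTo i Ms⟩
          ⟨.D 0, none, Φm, .decision r :: upTo i Mm⟩)
  -- conflicts at level 0
  | fail_s {i C Φs Ms Φm Mm} (hf : Falsified (upTo 0 Ms) C) :
      Step I Ws Wm (.run ⟨.D i, some C, Φs, Ms⟩ ⟨.P, none, Φm, Mm⟩)
        (.run ⟨.P, none, Φs, upTo i Ms⟩ ⟨.D 0, some ∅, insert ∅ Φm, upTo i Mm⟩)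
  | fail_m {α μ C Φs Ms Φm Mm} (hf : Falsified (upTo 0 Mm) C) :
      Step I Ws Wm (.run ⟨α, none, Φs, Ms⟩ ⟨μ, some C, Φm, Mm⟩) .unsat

/-- The configurations that a run on `⟨Φs, Φm⟩` with interface variables `I` can reach. The
variables of a solver are those of its formula and the interface variables. -/
def Reachable {V : Type*} [DecidableEq V] (Φs Φm : Formula V) (I : Finset V) (c : Config V) :
    Prop :=
  Relation.ReflTransGen (Step I (vars Φs ∪ I) (vars Φm ∪ I)) (initial Φs Φm) c

end SpecSMS

/-! The two trails are kept in step (`PairInv`): they carry the same interface literals and level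
marks in the same order, every level is opened by a decision of one of the solvers, and no literal
is external on both trails. All database clauses, reasons and conflict clauses are consequences of
`Φs ∪ Φm`, and so are the literals of level 0 (`SolverInv`). `ModeInv` records who opened which
levels: after speculation has started at `i`, the secondary solver has no decision up to `i`, and
the main solver has none above `i`, or, during validation, none between `i` and `j`. A solver in
mode `F` whose finish has been recorded satisfies its original formula.

Soundness. A variable on both trails is an interface variable, on which the trails agree; hence in
`⟨F, F⟩` their union is consistent, and it satisfies both formulas. Conversely, a consequence that
is false at level 0 is false in every model, so there is no model.

Progress. A false literal that admits neither Explain nor Reason is false by a decision or by an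
external literal whose final analysis fails. Two facts drive the case analysis over modes. Up to a
level at which a solver has no decision, its trail consists of propagated and shared literals, so
all local literals can be resolved away and final analysis succeeds
(`GoodTrail.exists_analyzeFinal`). And a trail has at most one decision per level, so a conflict
whose top-level literals are all decisions is asserting one level below (`GoodTrail.exists_level`).
What remains is an interface literal assigned above level `i`, and Refine applies to it.

Termination. `energy` decreases lexicographically. Its first component reads the trails level by
level, low levels first. The value of a level counts two points for each literal on either trail up
to it, and a weight exceeding everything else for each main decision, because Refine trades literals
for one main decision. A back-jump gains nothing at its target level except a clause that has become
unit; so `bonus` grants at the current level one point for a unit clause and one for a conflict.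
Propagation uses up the first point but earns at least two. All values are bounded in terms of the
numbers of variables. The other components handle steps that need not raise the trails: mode and
owner of the conflict (`rank`), clauses still to be learned, external justifications, and the
position of the conflict clause on the trail (`weight`). -/

namespace SpecSMS

/-! ### Literals and trails -/

section Trails

variable {V : Type*}

@[simp] theorem lit_neg_neg (l : Lit V) : neg (neg l) = l := by simp [neg]

@[simp] theorem neg_fst (l : Lit V) : (neg l).1 = l.1 := rfl

theorem neg_ne (l : Lit V) : neg l ≠ l := by
  intro h
  have := congrArg Prod.snd h
  simp [neg] at this

theorem eq_or_eq_neg {l r : Lit V} (h : r.1 = l.1) : r = l ∨ r = neg l := by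
  obtain ⟨v, b⟩ := l
  obtain ⟨w, c⟩ := r
  cases b <;> cases c <;> simp_all [neg]

@[simp] theorem lits_nil : lits ([] : Trail V) = ∅ := by simp [lits]

theorem mem_lits_cons {e : Entry V} {M : Trail V} {l : Lit V} :
    l ∈ lits (e :: M) ↔ e.lit? = some l ∨ l ∈ lits M := by simp [lits]

theorem lits_subset_of_suffix {M N : Trail V} (h : M <:+ N) : lits M ⊆ lits N :=
  fun _ ⟨e, he, hl⟩ => ⟨e, h.subset he, hl⟩

theorem level_cons (e : Entry V) (M : Trail V) :
    level (e :: M) = level M + if e.opensLevel then 1 else 0 := by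
  simp [level, List.countP_cons]

theorem upTo_suffix (k : ℕ) (M : Trail V) : upTo k M <:+ M := by
  induction M with
  | nil => simp [upTo]
  | cons e M ih =>
    unfold upTo
    split_ifs
    · exact List.suffix_rfl
    · exact ih.trans (List.suffix_cons _ _)

theorem upTo_of_le {k : ℕ} {M : Trail V} (h : level M ≤ k) : upTo k M = M := by
  cases M with
  | nil => rfl
  | cons e M => simp [upTo, h]

theorem upTo_cons_of_lt {k : ℕ} {e : Entry V} {M : Trail V} (h : k < level (e :: M)) :
    upTo k (e :: M) = upTo k M := by
  simp [upTo, h]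

theorem level_le_level_cons (e : Entry V) (M : Trail V) : level M ≤ level (e :: M) := by
  rw [level_cons]; omega

theorem level_upTo (k : ℕ) (M : Trail V) : level (upTo k M) = min k (level M) := by
  induction M with
  | nil => simp [upTo, level]
  | cons e M ih =>
    by_cases h : level (e :: M) ≤ k
    · rw [upTo_of_le h]; omega
    · rw [upTo_cons_of_lt (by omega), ih]
      have := level_cons e M
      split_ifs at this <;> omega

theorem upTo_upTo (k k' : ℕ) (M : Trail V) : upTo k (upTo k' M) = upTo (min k k') M := by
  induction M with
  | nil => rfl
  | cons e M ih =>
    by_cases h : level (e :: M) ≤ k'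
    · rw [upTo_of_le h]
      by_cases h' : level (e :: M) ≤ k
      · rw [upTo_of_le h', upTo_of_le (by omega)]
      · rw [min_eq_left (by omega)]
    · rw [upTo_cons_of_lt (by omega), ih, upTo_cons_of_lt (by omega)]

theorem upTo_suffix_upTo {k k' : ℕ} (h : k ≤ k') (M : Trail V) : upTo k M <:+ upTo k' M := by
  have := upTo_suffix k (upTo k' M)
  rwa [upTo_upTo, min_eq_left h] at this

theorem upTo_suffix_cons (k : ℕ) (e : Entry V) (M : Trail V) : upTo k M <:+ upTo k (e :: M) := by
  by_cases h : level (e :: M) ≤ k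
  · rw [upTo_of_le h]
    exact (upTo_suffix k M).trans (List.suffix_cons _ _)
  · rw [upTo_cons_of_lt (by omega)]

theorem lits_upTo_subset (k : ℕ) (M : Trail V) : lits (upTo k M) ⊆ lits M :=
  lits_subset_of_suffix (upTo_suffix k M)

theorem lits_upTo_mono {k k' : ℕ} (h : k ≤ k') (M : Trail V) :
    lits (upTo k M) ⊆ lits (upTo k' M) :=
  lits_subset_of_suffix (upTo_suffix_upTo h M)

theorem lits_upTo_subset_cons (k : ℕ) (e : Entry V) (M : Trail V) :
    lits (upTo k M) ⊆ lits (upTo k (e :: M)) :=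
  lits_subset_of_suffix (upTo_suffix_cons k e M)

/-- Two decisions of the same level coincide. -/
theorem decision_unique {k : ℕ} {M : Trail V} {a b : Lit V}
    (ha : .decision a ∈ upTo (k + 1) M) (hb : .decision b ∈ upTo (k + 1) M)
    (ha' : .decision a ∉ upTo k M) (hb' : .decision b ∉ upTo k M) : a = b := by
  induction M with
  | nil => simp [upTo] at ha
  | cons e M ih =>
    by_cases h : level (e :: M) ≤ k + 1
    · by_cases h' : level (e :: M) ≤ k
      · rw [upTo_of_le h'] at ha'
        rw [upTo_of_le h] at ha
        exact absurd ha ha'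
      · rw [upTo_cons_of_lt (by omega)] at ha' hb'
        have hl := level_cons e M
        split_ifs at hl with ho
        · rw [upTo_of_le h] at ha hb
          rw [upTo_of_le (by omega)] at ha' hb'
          simp only [List.mem_cons, ha', hb', or_false] at ha hb
          rw [← ha] at hb
          injection hb with hb
          exact hb.symm
        · rw [upTo_of_le h] at ha hb
          have : ∀ l, Entry.decision l ≠ e := by
            rintro l rfl
            simp [Entry.opensLevel] at ho
          simp only [List.mem_cons, this, false_or] at ha hb
          rw [upTo_of_le (by omega)] at ih
          exact ih ha hb ha' hb'
    · rw [upTo_cons_of_lt (by omega)] at ha hb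
      rw [upTo_cons_of_lt (by omega)] at ha' hb'
      exact ih ha hb ha' hb'

theorem Falsified.mono {M N : Trail V} {C : Clause V} (h : Falsified M C)
    (hs : lits M ⊆ lits N) : Falsified N C := fun l hl => hs (h l hl)

/-- The number of decisions on a trail. -/
def decs (M : Trail V) : ℕ := M.countP fun e => match e with | .decision _ => true | _ => false

/-- The number of literals on a trail. -/
def numLits (M : Trail V) : ℕ := M.countP fun e => e.lit?.isSome

/-- The number of literals with an external justification on a trail. -/
def numExt (M : Trail V) : ℕ := M.countP fun e => match e with | .ext _ => true | _ => false

theorem decs_le_of_suffix {M N : Trail V} (h : M <:+ N) : decs M ≤ decs N :=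
  h.sublist.countP_le

theorem numLits_le_of_suffix {M N : Trail V} (h : M <:+ N) : numLits M ≤ numLits N :=
  h.sublist.countP_le

@[simp] theorem decs_decision (l : Lit V) (M : Trail V) : decs (.decision l :: M) = decs M + 1 := by
  simp [decs]
@[simp] theorem decs_null (M : Trail V) : decs (.null :: M) = decs M := by simp [decs]
@[simp] theorem decs_prop (l : Lit V) (R : Clause V) (M : Trail V) :
    decs (.prop l R :: M) = decs M := by simp [decs]
@[simp] theorem decs_ext (l : Lit V) (M : Trail V) : decs (.ext l :: M) = decs M := by simp [decs]

theorem numLits_cons (e : Entry V) (M : Trail V) :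
    numLits (e :: M) = numLits M + if e.lit?.isSome then 1 else 0 := by
  simp [numLits, List.countP_cons]

theorem decs_le_numLits (M : Trail V) : decs M ≤ numLits M := by
  refine List.countP_mono_left fun e _ => ?_
  cases e <;> simp [Entry.lit?]

theorem decision_notMem {M : Trail V} (h : decs M = 0) (l : Lit V) : .decision l ∉ M := by
  intro hl
  have := (List.countP_eq_zero.1 h) _ hl
  simp at this

/-- The mode invariants locate decisions by counting them; this turns an inequality of counts back
into membership, since the removed part can contain no decision. -/
theorem decision_mem_of_decs_le {M N : Trail V} (hs : N <:+ M) (h : decs M ≤ decs N) {l : Lit V}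
    (hl : .decision l ∈ M) : .decision l ∈ N := by
  obtain ⟨P, rfl⟩ := hs
  have : decs P = 0 := by
    simp only [decs, List.countP_append] at h ⊢
    omega
  rcases List.mem_append.1 hl with hl | hl
  · exact absurd hl (decision_notMem this l)
  · exact hl

/-! ### Replacing external justifications -/

theorem setReason_cons (l : Lit V) (c : Clause V) (e : Entry V) (M : Trail V) :
    setReason l c (e :: M) =
      (open Classical in if e = .ext l then .prop l c else e) :: setReason l c M := rfl

theorem lit?_setReason (l : Lit V) (c : Clause V) (e : Entry V) :
    (open Classical in if e = .ext l then .prop l c else e).lit? = e.lit? := by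
  split_ifs with h
  · rw [h]; rfl
  · rfl

theorem opensLevel_setReason (l : Lit V) (c : Clause V) (e : Entry V) :
    (open Classical in if e = .ext l then .prop l c else e).opensLevel = e.opensLevel := by
  split_ifs with h
  · rw [h]; rfl
  · rfl

@[simp] theorem lits_setReason (l : Lit V) (c : Clause V) (M : Trail V) :
    lits (setReason l c M) = lits M := by
  induction M with
  | nil => rfl
  | cons e M ih =>
    ext x
    rw [setReason_cons, mem_lits_cons, mem_lits_cons, lit?_setReason, ih]

@[simp] theorem level_setReason (l : Lit V) (c : Clause V) (M : Trail V) :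
    level (setReason l c M) = level M := by
  induction M with
  | nil => rfl
  | cons e M ih => rw [setReason_cons, level_cons, level_cons, opensLevel_setReason, ih]

theorem upTo_setReason (k : ℕ) (l : Lit V) (c : Clause V) (M : Trail V) :
    upTo k (setReason l c M) = setReason l c (upTo k M) := by
  induction M with
  | nil => rfl
  | cons e M ih =>
    by_cases h : level (e :: M) ≤ k
    · rw [upTo_of_le h, upTo_of_le (by simpa using h)]
    · rw [upTo_cons_of_lt (by omega : k < level (e :: M)), ← ih]
      have h' : k < level (setReason l c (e :: M)) := by rw [level_setReason]; omega
      rw [setReason_cons] at h' ⊢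
      exact upTo_cons_of_lt h'

@[simp] theorem decs_setReason (l : Lit V) (c : Clause V) (M : Trail V) :
    decs (setReason l c M) = decs M := by
  induction M with
  | nil => rfl
  | cons e M ih =>
    rw [setReason_cons]
    split_ifs with h
    · simp [h, ih]
    · cases e <;> simp [ih]

@[simp] theorem numLits_setReason (l : Lit V) (c : Clause V) (M : Trail V) :
    numLits (setReason l c M) = numLits M := by
  induction M with
  | nil => rfl
  | cons e M ih => rw [setReason_cons, numLits_cons, numLits_cons, lit?_setReason, ih]

theorem numExt_setReason_le (l : Lit V) (c : Clause V) (M : Trail V) :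
    numExt (setReason l c M) ≤ numExt M := by
  induction M with
  | nil => rfl
  | cons e M ih =>
    rw [setReason_cons]
    split_ifs with h
    · simp only [numExt, h, List.countP_cons] at ih ⊢; simp; omega
    · simp only [numExt, List.countP_cons] at ih ⊢; omega

theorem numExt_setReason_lt {l : Lit V} (c : Clause V) {M : Trail V} (h : .ext l ∈ M) :
    numExt (setReason l c M) < numExt M := by
  induction M with
  | nil => simp at h
  | cons e M ih =>
    rw [setReason_cons]
    have := numExt_setReason_le l c M
    split_ifs with he
    · simp only [numExt, he, List.countP_cons] at this ⊢; simp; omega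
    · have := ih ((List.mem_cons.1 h).resolve_left fun h => he h.symm)
      simp only [numExt, List.countP_cons] at this ⊢; omega

theorem mem_setReason {l : Lit V} {c : Clause V} {M : Trail V} {e : Entry V}
    (h : e ∈ setReason l c M) : e = .prop l c ∨ e ∈ M := by
  simp only [setReason, List.mem_map] at h
  obtain ⟨x, hx, rfl⟩ := h
  split_ifs
  · exact .inl rfl
  · exact .inr hx

theorem ext_mem_of_setReason {l x : Lit V} {c : Clause V} {M : Trail V}
    (h : .ext x ∈ setReason l c M) : .ext x ∈ M :=
  (mem_setReason h).resolve_left (by simp)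

end Trails

/-! ### Consequences of a formula -/

section Implied

variable {V : Type*}

/-- The assignment `a` satisfies every clause of `Φ`. -/
def Models (a : V → Bool) (Φ : Formula V) : Prop := ∀ C ∈ Φ, ∃ l ∈ C, a l.1 = l.2

/-- The clause `C` is a consequence of `Φ`. -/
def Implied (Φ : Formula V) (C : Clause V) : Prop :=
  ∀ a, Models a Φ → ∃ l ∈ C, a l.1 = l.2

theorem Implied.of_mem {Φ : Formula V} {C : Clause V} (h : C ∈ Φ) : Implied Φ C :=
  fun _ ha => ha C h

theorem ne_neg_snd {a : V → Bool} {l : Lit V} (h : a l.1 = l.2) : a (neg l).1 ≠ (neg l).2 := by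
  simp [neg, h]

theorem Implied.resolvent [DecidableEq V] {Φ : Formula V} {C R : Clause V} (l : Lit V)
    (hC : Implied Φ C) (hR : Implied Φ R) : Implied Φ (resolvent l C R) := by
  intro a ha
  obtain ⟨x, hx, hax⟩ := hC a ha
  obtain ⟨y, hy, hay⟩ := hR a ha
  by_cases hxl : x = neg l
  · have hyl : y ≠ l := by
      rintro rfl
      exact ne_neg_snd hay (hxl ▸ hax)
    exact ⟨y, by simp [SpecSMS.resolvent, hy, hyl], hay⟩
  · exact ⟨x, by simp [SpecSMS.resolvent, hx, hxl], hax⟩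

end Implied

/-! ### Well-formed trails -/

section GoodTrail

variable {V : Type*}

/-- The entry `e` may extend the trail `M` of a solver with variables `W`. -/
structure GoodEntry (I W : Finset V) (Φ : Formula V) (M : Trail V) (e : Entry V) : Prop where
  lit : ∀ l, e.lit? = some l → l.1 ∈ W ∧ Unassigned M l
  ext : ∀ l, e = .ext l → l.1 ∈ I
  reason : ∀ l R, e = .prop l R → l ∈ R ∧ (∀ x ∈ R, x ≠ l → neg x ∈ lits M) ∧ Implied Φ R

/-- Every entry of the trail `M` is well-formed with respect to the entries before it. -/
def GoodTrail (I W : Finset V) (Φ : Formula V) (M : Trail V) : Prop :=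
  ∀ e N, e :: N <:+ M → GoodEntry I W Φ N e

variable {I W : Finset V} {Φ : Formula V} {M N : Trail V}

theorem goodTrail_nil : GoodTrail I W Φ [] := fun e N h => by simp at h

theorem goodTrail_cons {e : Entry V} :
    GoodTrail I W Φ (e :: M) ↔ GoodEntry I W Φ M e ∧ GoodTrail I W Φ M := by
  constructor
  · exact fun h => ⟨h e M List.suffix_rfl, fun f N hf => h f N (hf.trans (List.suffix_cons _ _))⟩
  · rintro ⟨h1, h2⟩ f N hf
    rcases List.suffix_cons_iff.1 hf with hf | hf
    · injection hf with h h'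
      subst h h'
      exact h1
    · exact h2 f N hf

theorem GoodTrail.suffix (h : GoodTrail I W Φ M) (hs : N <:+ M) : GoodTrail I W Φ N :=
  fun e K hK => h e K (hK.trans hs)

theorem exists_suffix_of_mem {α : Type*} {e : α} {M : List α} (h : e ∈ M) :
    ∃ N, e :: N <:+ M := by
  obtain ⟨A, N, rfl⟩ := List.append_of_mem h
  exact ⟨N, List.suffix_append _ _⟩

theorem GoodTrail.mem_vars (h : GoodTrail I W Φ M) {l : Lit V} (hl : l ∈ lits M) : l.1 ∈ W := by
  obtain ⟨e, he, hel⟩ := hl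
  obtain ⟨N, hN⟩ := exists_suffix_of_mem he
  exact ((h e N hN).lit l hel).1

theorem GoodTrail.neg_notMem (h : GoodTrail I W Φ M) {l : Lit V} (hl : l ∈ lits M) :
    neg l ∉ lits M := by
  induction M with
  | nil => simp at hl
  | cons e M ih =>
    rw [goodTrail_cons] at h
    have key : ∀ x, e.lit? = some x → Unassigned M x := fun x hx => (h.1.lit x hx).2
    rw [mem_lits_cons] at hl ⊢
    rintro (hn | hn)
    · rcases hl with hl | hl
      · rw [hn] at hl
        exact neg_ne l (Option.some.inj hl)
      · exact (key _ hn).2 (by simpa using hl)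
    · rcases hl with hl | hl
      · exact (key _ hl).2 hn
      · exact ih h.2 hl hn

theorem GoodTrail.ext_mem (h : GoodTrail I W Φ M) {l : Lit V} (hl : .ext l ∈ M) : l.1 ∈ I := by
  obtain ⟨N, hN⟩ := exists_suffix_of_mem hl
  exact (h _ N hN).ext l rfl

/-- A literal that occurs in a suffix of the trail occurs nowhere else. -/
theorem GoodTrail.mem_of_suffix (h : GoodTrail I W Φ M) (hs : N <:+ M) {e : Entry V} {l : Lit V}
    (he : e ∈ M) (hl : e.lit? = some l) (hN : l ∈ lits N) : e ∈ N := by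
  obtain ⟨P, rfl⟩ := hs
  induction P with
  | nil => exact he
  | cons f P ih =>
    rw [List.cons_append, goodTrail_cons] at h
    rcases List.mem_cons.1 he with rfl | he
    · exact absurd (lits_subset_of_suffix (List.suffix_append P N) hN) (h.1.lit l hl).2.1
    · exact ih h.2 he

/-- Each literal is unassigned when it is added, so it contributes a new variable of `W`. -/
theorem GoodTrail.numLits_le [DecidableEq V] (h : GoodTrail I W Φ M) : numLits M ≤ W.card := by
  suffices ∃ S : Finset V, S.card = numLits M ∧ S ⊆ W ∧ ∀ v ∈ S, ∃ l ∈ lits M, l.1 = v by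
    obtain ⟨S, h1, h2, -⟩ := this
    exact h1 ▸ Finset.card_le_card h2
  induction M with
  | nil => exact ⟨∅, by simp [numLits]⟩
  | cons e M ih =>
    rw [goodTrail_cons] at h
    obtain ⟨S, h1, h2, h3⟩ := ih h.2
    rw [numLits_cons]
    cases he : e.lit? with
    | none => exact ⟨S, by simpa using h1, h2, fun v hv =>
        (h3 v hv).imp fun l hl => ⟨mem_lits_cons.2 (.inr hl.1), hl.2⟩⟩
    | some l =>
      obtain ⟨hW, hu⟩ := h.1.lit l he
      refine ⟨insert l.1 S, ?_, ?_, ?_⟩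
      · rw [Finset.card_insert_of_notMem, h1]
        · simp
        · intro hl
          obtain ⟨x, hx, hxl⟩ := h3 _ hl
          rcases eq_or_eq_neg hxl with rfl | rfl
          · exact hu.1 hx
          · exact hu.2 hx
      · exact Finset.insert_subset hW h2
      · intro v hv
        rcases Finset.mem_insert.1 hv with rfl | hv
        · exact ⟨l, mem_lits_cons.2 (.inl he), rfl⟩
        · exact (h3 v hv).imp fun l hl => ⟨mem_lits_cons.2 (.inr hl.1), hl.2⟩

theorem GoodTrail.setReason (h : GoodTrail I W Φ M) {l : Lit V} {c : Clause V}
    (hc : ∀ N, .ext l :: N <:+ M → l ∈ c ∧ ∀ x ∈ c, x ≠ l → neg x ∈ lits N)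
    (hi : Implied Φ c) : GoodTrail I W Φ (setReason l c M) := by
  induction M with
  | nil => exact h
  | cons e M ih =>
    rw [goodTrail_cons] at h
    rw [setReason_cons, goodTrail_cons]
    refine ⟨?_, ih h.2 fun N hN => hc N (hN.trans (List.suffix_cons _ _))⟩
    split_ifs with he
    · subst he
      obtain ⟨h1, h2⟩ := hc M List.suffix_rfl
      refine ⟨fun x hx => ?_, by simp, ?_⟩
      · have := h.1.lit x hx
        simpa [Unassigned] using this
      · rintro x R hx
        injection hx with hx hR
        subst hx hR
        exact ⟨h1, by simpa using h2, hi⟩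
    · refine ⟨fun x hx => ?_, h.1.ext, fun x R hx => ?_⟩
      · have := h.1.lit x hx
        simpa [Unassigned] using this
      · simpa using h.1.reason x R hx

end GoodTrail

/-! ### The weight of a clause under a trail -/

section Weight

variable {V : Type*} [DecidableEq V]

/-- The number whose binary digits are the positions on the trail of the complements of the
literals of `C`. -/
def weight (C : Clause V) : Trail V → ℕ
  | [] => 0
  | e :: M => (if ∃ l, e.lit? = some l ∧ neg l ∈ C then 2 ^ M.length else 0) + weight C M

theorem weight_lt (C : Clause V) (M : Trail V) : weight C M < 2 ^ M.length := by
  induction M with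
  | nil => simp [weight]
  | cons e M ih =>
    rw [weight, List.length_cons, pow_succ]
    split_ifs <;> omega

theorem mem_resolvent {l x : Lit V} {C R : Clause V} :
    x ∈ resolvent l C R ↔ (x ∈ C ∧ x ≠ neg l) ∨ (x ∈ R ∧ x ≠ l) := by
  simp [resolvent, and_comm]

variable {I W : Finset V} {Φ : Formula V} {M N : Trail V}

/-- The resolution clears the binary digit at the position of `l`. Since the other literals of `R`
became false before `l` was added, it can set digits only at older, less significant positions. -/
theorem GoodTrail.weight_resolvent_lt (h : GoodTrail I W Φ M) {l : Lit V} {C R : Clause V}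
    (hR : .prop l R ∈ M) (hC : neg l ∈ C) : weight (resolvent l C R) M < weight C M := by
  induction M with
  | nil => simp at hR
  | cons e M ih =>
    rw [goodTrail_cons] at h
    rw [weight, weight]
    rcases List.mem_cons.1 hR with rfl | hR
    · rw [if_neg, if_pos ⟨l, rfl, hC⟩]
      · have := weight_lt (resolvent l C R) M
        omega
      · rintro ⟨x, hx, hxR⟩
        cases hx
        obtain ⟨-, hr, -⟩ := h.1.reason l R rfl
        rw [mem_resolvent] at hxR
        rcases hxR with hx | hx
        · exact hx.2 rfl
        · have := hr _ hx.1 hx.2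
          rw [lit_neg_neg] at this
          exact (h.1.lit l rfl).2.1 this
    · have h1 := ih h.2 hR
      obtain ⟨N, hN⟩ := exists_suffix_of_mem hR
      obtain ⟨-, hr, -⟩ := (h.2 _ N hN).reason l R rfl
      -- An entry newer than `l` cannot match a literal of the reason, whose complement was already
      -- assigned; so digits above that of `l` are not newly set.
      have : (∃ x, e.lit? = some x ∧ neg x ∈ resolvent l C R) → ∃ x, e.lit? = some x ∧ neg x ∈ C := by
        rintro ⟨x, hx, hxR⟩
        refine ⟨x, hx, ?_⟩
        rw [mem_resolvent] at hxR
        rcases hxR with hxR | hxR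
        · exact hxR.1
        · have h3 := hr _ hxR.1 hxR.2
          rw [lit_neg_neg] at h3
          exact absurd (lits_subset_of_suffix ((List.suffix_cons _ _).trans hN) h3)
            (h.1.lit x hx).2.1
      have h6 := Nat.two_pow_pos M.length
      split_ifs with h4 h5
      · omega
      · exact absurd (this h4) h5
      · omega
      · omega

theorem Falsified.resolvent (hM : GoodTrail I W Φ M) {l : Lit V} {C R : Clause V}
    (hC : Falsified M C) (hR : .prop l R ∈ M) : Falsified M (resolvent l C R) := by
  intro x hx
  obtain ⟨N, hN⟩ := exists_suffix_of_mem hR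
  rcases mem_resolvent.1 hx with hx | hx
  · exact hC x hx.1
  · exact lits_subset_of_suffix ((List.suffix_cons _ _).trans hN)
      (((hM _ N hN).reason l R rfl).2.1 x hx.1 hx.2)

theorem Resolves.implied (hM : GoodTrail I W Φ M) {R c : Clause V} (h : Resolves M R c)
    (hR : Implied Φ R) : Implied Φ c := by
  induction h with
  | refl => exact hR
  | step _ _ hp ih =>
    obtain ⟨N, hN⟩ := exists_suffix_of_mem hp
    exact ih.resolvent _ ((hM _ N hN).reason _ _ rfl).2.2

/-- The pivots other than `l` are older than `l`, and their reasons bring in literals that are older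
still; so `l` is never resolved away, and every clause obtained is still a valid reason for `l` at
its position. -/
theorem Resolves.reason (hM : GoodTrail I W Φ M) {l : Lit V} {R c : Clause V}
    (hR : .prop l R :: N <:+ M) (h : Resolves M R c) :
    l ∈ c ∧ ∀ x ∈ c, x ≠ l → neg x ∈ lits N := by
  have hg := hM _ N hR
  have hN : N <:+ M := (List.suffix_cons _ _).trans hR
  induction h with
  | refl => exact ⟨(hg.reason l R rfl).1, (hg.reason l R rfl).2.1⟩
  | @step D S y _ hy hp ih =>
    obtain ⟨h1, h2⟩ := ih
    have hyl : neg y ≠ l := by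
      rintro rfl
      have hy1 : y ∈ lits M := ⟨_, hp, rfl⟩
      exact hM.neg_notMem hy1 ⟨_, hR.mem List.mem_cons_self, rfl⟩
    have hyN : y ∈ lits N := by simpa using h2 _ hy hyl
    have hpN := hM.mem_of_suffix hN hp rfl hyN
    obtain ⟨K, hK⟩ := exists_suffix_of_mem hpN
    refine ⟨mem_resolvent.2 (.inl ⟨h1, hyl.symm⟩), fun x hx hxl => ?_⟩
    rcases mem_resolvent.1 hx with hx | hx
    · exact h2 x hx.1 hxl
    · exact lits_subset_of_suffix ((List.suffix_cons _ _).trans hK)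
        (((hM _ K (hK.trans hN)).reason y S rfl).2.1 x hx.1 hx.2)

/-- The final analysis of a propagated interface literal succeeds if there is no decision at or
below its level. -/
theorem GoodTrail.exists_analyzeFinal (hM : GoodTrail I W Φ M) {k : ℕ}
    (hd : decs (upTo k M) = 0) {l : Lit V} {R : Clause V} (hR : .prop l R ∈ upTo k M)
    (hl : l.1 ∈ I) : ∃ c, AnalyzeFinal I M l c := by
  have hs := upTo_suffix k M
  -- Local literals are resolved away one at a time; the weight of the clause bounds how long this
  -- can go on.
  suffices key : ∀ n D, weight D (upTo k M) = n → Resolves M R D →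
      ∃ c, Shared I c ∧ Resolves M R c by
    obtain ⟨c, h1, h2⟩ := key _ R rfl .refl
    exact ⟨c, h1, R, hs.subset hR, h2⟩
  intro n
  induction n using Nat.strong_induction_on with
  | _ n ih =>
    rintro D rfl hD
    by_cases hsh : Shared I D
    · exact ⟨D, hsh, hD⟩
    · simp only [Shared, not_forall] at hsh
      obtain ⟨x, hx, hxI⟩ := hsh
      obtain ⟨N, hN⟩ := exists_suffix_of_mem hR
      -- The complement of the local literal `x` precedes `l`, hence also lies on `upTo k M`. It is
      -- no decision by assumption, and not external because external literals are shared; so it has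
      -- a reason clause.
      have hxN := (hD.reason hM (hN.trans hs)).2 x hx (by rintro rfl; exact hxI hl)
      obtain ⟨e, he, hex⟩ := lits_subset_of_suffix ((List.suffix_cons _ _).trans hN) hxN
      cases e with
      | decision y => exact absurd he (decision_notMem hd y)
      | null => simp [Entry.lit?] at hex
      | ext y =>
        cases hex
        exact absurd (hM.ext_mem (hs.subset he)) hxI
      | prop y S =>
        cases hex
        have hx' : neg (neg x) ∈ D := by simpa using hx
        exact ih _ ((hM.suffix hs).weight_resolvent_lt he hx') _ rfl
          (hD.step hx' (hs.subset he))

end Weight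

/-! ### The part of a trail that both solvers have in common -/

section Interface

variable {V : Type*} [DecidableEq V]

/-- The traces of a trail entry in the other solver: an interface literal, and (as `none`) the
opening of a decision level. -/
def Entry.proj (I : Finset V) (e : Entry V) : List (Option (Lit V)) :=
  (match e.lit? with
    | some l => if l.1 ∈ I then [some l] else []
    | none => []) ++ if e.opensLevel then [none] else []

/-- The interface literals and the openings of decision levels on a trail. -/
def proj (I : Finset V) (M : Trail V) : List (Option (Lit V)) := M.flatMap (Entry.proj I)

variable {I W : Finset V} {Φ : Formula V} {M N : Trail V}

theorem proj_cons (e : Entry V) : proj I (e :: M) = e.proj I ++ proj I M := by simp [proj]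

theorem proj_append : proj I (M ++ N) = proj I M ++ proj I N := by simp [proj]

theorem level_eq_countP_proj (M : Trail V) : level M = (proj I M).countP Option.isNone := by
  induction M with
  | nil => rfl
  | cons e M ih =>
    rw [proj_cons, level_cons, List.countP_append, ih, Entry.proj]
    cases e <;> simp [Entry.lit?, Entry.opensLevel] <;> (try split_ifs) <;> simp [Nat.add_comm]

theorem level_eq_of_proj_eq (h : proj I M = proj I N) : level M = level N := by
  rw [level_eq_countP_proj (I := I), level_eq_countP_proj (I := I) N, h]

theorem mem_proj {l : Lit V} (hl : l.1 ∈ I) : some l ∈ proj I M ↔ l ∈ lits M := by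
  induction M with
  | nil => simp [proj]
  | cons e M ih =>
    rw [proj_cons, List.mem_append, ih, mem_lits_cons, Entry.proj]
    cases e with
    | null => simp [Entry.lit?, Entry.opensLevel]
    | _ x =>
      by_cases hx : x = l
      · subst hx; simp [Entry.lit?, Entry.opensLevel, hl]
      · by_cases hI : x.1 ∈ I <;> simp [Entry.lit?, Entry.opensLevel, hI, hx, Ne.symm hx]

theorem mem_lits_iff_of_proj_eq (h : proj I M = proj I N) {l : Lit V} (hl : l.1 ∈ I) :
    l ∈ lits M ↔ l ∈ lits N := by
  rw [← mem_proj hl, ← mem_proj hl, h]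

/-- The part of a projected trail at levels at most `k`. -/
def projUpTo {α : Type*} (k : ℕ) : List (Option α) → List (Option α)
  | [] => []
  | x :: xs => if (x :: xs).countP Option.isNone ≤ k then x :: xs else projUpTo k xs

theorem projUpTo_of_le {α : Type*} {k : ℕ} {xs : List (Option α)}
    (h : xs.countP Option.isNone ≤ k) : projUpTo k xs = xs := by
  cases xs with
  | nil => rfl
  | cons x xs => simp [projUpTo, h]

theorem projUpTo_append_of_lt {α : Type*} {k : ℕ} {xs ys : List (Option α)}
    (h : ∀ zs, zs <:+ xs → zs ≠ [] → k < zs.countP Option.isNone + ys.countP Option.isNone) :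
    projUpTo k (xs ++ ys) = projUpTo k ys := by
  induction xs with
  | nil => rfl
  | cons x xs ih =>
    have := h (x :: xs) List.suffix_rfl (by simp)
    rw [List.cons_append, projUpTo, if_neg]
    · exact ih fun zs hz => h zs (hz.trans (List.suffix_cons _ _))
    · rw [← List.cons_append, List.countP_append]; omega

/-- An entry can leave two traces, which a cut must not separate. The level mark is the last, i.e.
older, of the two, so every nonempty suffix of the traces of an opening entry contains it and is
dropped with the entry. -/
theorem proj_upTo (k : ℕ) (M : Trail V) : proj I (upTo k M) = projUpTo k (proj I M) := by
  induction M with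
  | nil => rfl
  | cons e M ih =>
    by_cases h : level (e :: M) ≤ k
    · rw [upTo_of_le h, projUpTo_of_le (by rwa [← level_eq_countP_proj])]
    · rw [upTo_cons_of_lt (by omega), ih, proj_cons, projUpTo_append_of_lt]
      intro zs hz hne
      rw [← level_eq_countP_proj]
      rw [level_cons] at h
      suffices (if e.opensLevel then 1 else 0) ≤ zs.countP Option.isNone by omega
      rw [Entry.proj] at hz
      split_ifs at hz ⊢ with ho
      · obtain ⟨z, zs', rfl⟩ := List.exists_cons_of_ne_nil hne
        obtain ⟨P, hP⟩ := hz
        have h1 : (z :: zs').getLast? = some none := by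
          have := congrArg List.getLast? hP
          rw [List.getLast?_append_of_ne_nil _ hne] at this
          rw [this]; simp
        have : none ∈ z :: zs' := List.mem_of_getLast? h1
        exact List.countP_pos_iff.2 ⟨_, this, rfl⟩
      · omega

theorem proj_upTo_eq (h : proj I M = proj I N) (k : ℕ) :
    proj I (upTo k M) = proj I (upTo k N) := by rw [proj_upTo, proj_upTo, h]

@[simp] theorem proj_setReason (l : Lit V) (c : Clause V) (M : Trail V) :
    proj I (setReason l c M) = proj I M := by
  induction M with
  | nil => rfl
  | cons e M ih =>
    rw [setReason_cons, proj_cons, proj_cons, ih, Entry.proj, Entry.proj, lit?_setReason,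
      opensLevel_setReason]

/-- Interface literals have the same order on both trails. -/
theorem mem_lits_of_proj_eq {W' : Finset V} {M' N' : Trail V} (hM : GoodTrail I W Φ M)
    (hN : GoodTrail I W' Φ N)
    (h : proj I M = proj I N) {e f : Entry V} {l x : Lit V} (he : e.proj I = [some l])
    (hf : f.proj I = [some l]) (heM : e :: M' <:+ M) (hfN : f :: N' <:+ N) (hl : l.1 ∈ I)
    (hel : e.lit? = some l) (hfl : f.lit? = some l)
    (hx : x.1 ∈ I) (hxN : x ∈ lits N') : x ∈ lits M' := by
  have h1 := ((hM e M' heM).lit l hel).2.1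
  obtain ⟨A, rfl⟩ := heM
  obtain ⟨B, rfl⟩ := hfN
  -- No literal is assigned twice, so `some l` occurs once in a projection and the two equal
  -- projections split at it in the same way.
  have key : ∀ {W : Finset V} {A : Trail V} {e : Entry V} {M' : Trail V},
      GoodTrail I W Φ (A ++ e :: M') → e.lit? = some l → some l ∉ proj I A := by
    intro W A e M' hA hel hmem
    rw [mem_proj hl] at hmem
    clear he hM h h1
    induction A with
    | nil => simp at hmem
    | cons g A ih =>
      rw [List.cons_append, goodTrail_cons] at hA
      rcases mem_lits_cons.1 hmem with hmem | hmem
      · exact (hA.1.lit l hmem).2.1 ⟨e, by simp, hel⟩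
      · exact ih hA.2 hmem
  rw [proj_append, proj_append, proj_cons, proj_cons, he, hf, List.singleton_append,
    List.singleton_append] at h
  have hB := key hN hfl
  rw [← mem_proj hl] at h1
  rw [← mem_proj hx] at hxN ⊢
  have hA := key hM hel
  rw [List.append_cons_inj_of_notMem] at h
  · rw [h.2.2]; exact hxN
  · exact hA
  · exact h1

end Interface

/-! ### Invariants that do not depend on the search modes -/

section PairInv

variable {V : Type*}

/-- The invariant of a solver with variables `W` that started from the formula `Φ`. All its clauses
are consequences of `Φ₀`. -/
structure SolverInv (I W : Finset V) (Φ₀ Φ : Formula V) (c : Option (Clause V)) (D : Formula V)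
    (M : Trail V) : Prop where
  good : GoodTrail I W Φ₀ M
  subset : Φ ⊆ D
  dbVars : ∀ C ∈ D, ∀ x ∈ C, x.1 ∈ W
  dbImplied : ∀ C ∈ D, Implied Φ₀ C
  conf : ∀ C, c = some C → Falsified M C ∧ Implied Φ₀ C
  zero : ∀ a, Models a Φ₀ → ∀ l ∈ lits (upTo 0 M), a l.1 = l.2

variable {I W : Finset V} {Φ₀ Φ : Formula V} {c : Option (Clause V)} {D : Formula V} {M : Trail V}

theorem SolverInv.upTo (h : SolverInv I W Φ₀ Φ c D M) (k : ℕ) :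
    SolverInv I W Φ₀ Φ none D (upTo k M) where
  good := h.good.suffix (upTo_suffix k M)
  subset := h.subset
  dbVars := h.dbVars
  dbImplied := h.dbImplied
  conf := by simp
  zero := by
    intro a ha l hl
    rw [upTo_upTo, Nat.zero_min] at hl
    exact h.zero a ha l hl

theorem SolverInv.setConf (h : SolverInv I W Φ₀ Φ c D M) {c₁ : Option (Clause V)}
    (hc : ∀ C, c₁ = some C → Falsified M C ∧ Implied Φ₀ C) : SolverInv I W Φ₀ Φ c₁ D M :=
  { h with conf := hc }

theorem SolverInv.vars_of_falsified (h : SolverInv I W Φ₀ Φ c D M) {C : Clause V}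
    (hC : Falsified M C) : ∀ x ∈ C, x.1 ∈ W :=
  fun x hx => h.good.mem_vars (l := neg x) (hC x hx)

theorem SolverInv.cons (h : SolverInv I W Φ₀ Φ none D M) {e : Entry V}
    (he : GoodEntry I W Φ₀ M e)
    (h0 : ∀ a, Models a Φ₀ → level M = 0 → e.opensLevel = false →
      ∀ l, e.lit? = some l → a l.1 = l.2) :
    SolverInv I W Φ₀ Φ none D (e :: M) where
  good := goodTrail_cons.2 ⟨he, h.good⟩
  subset := h.subset
  dbVars := h.dbVars
  dbImplied := h.dbImplied
  conf := by simp
  zero := by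
    intro a ha l hl
    by_cases hlev : level (e :: M) ≤ 0
    · rw [upTo_of_le hlev] at hl
      rw [level_cons] at hlev
      rcases mem_lits_cons.1 hl with hl | hl
      · refine h0 a ha (by omega) ?_ l hl
        by_contra ho
        simp [ho] at hlev
      · refine h.zero a ha l ?_
        rwa [upTo_of_le (by omega)]
    · rw [upTo_cons_of_lt (by omega)] at hl
      exact h.zero a ha l hl

theorem GoodEntry.null : GoodEntry I W Φ₀ M .null :=
  ⟨by simp [Entry.lit?], by simp, by simp⟩

theorem GoodEntry.decision {l : Lit V} (hW : l.1 ∈ W) (hu : Unassigned M l) :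
    GoodEntry I W Φ₀ M (.decision l) :=
  ⟨by rintro x ⟨⟩; exact ⟨hW, hu⟩, by simp, by simp⟩

theorem GoodEntry.of_ext {l : Lit V} (hW : l.1 ∈ W) (hI : l.1 ∈ I) (hu : Unassigned M l) :
    GoodEntry I W Φ₀ M (.ext l) :=
  ⟨by rintro x ⟨⟩; exact ⟨hW, hu⟩, by rintro x ⟨⟩; exact hI, by simp⟩

theorem GoodEntry.prop {l : Lit V} {C : Clause V} (hW : l.1 ∈ W) (hC : UnitUnder M C l)
    (hi : Implied Φ₀ C) : GoodEntry I W Φ₀ M (.prop l C) :=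
  ⟨by rintro x ⟨⟩; exact ⟨hW, hC.2.1⟩, by simp, by rintro x R ⟨⟩; exact ⟨hC.1, hC.2.2, hi⟩⟩

/-- In a model all level-0 literals hold, which makes every other literal of `C` false. -/
theorem SolverInv.unit_true (h : SolverInv I W Φ₀ Φ c D M) {C : Clause V} {l : Lit V}
    (hi : Implied Φ₀ C) (hu : UnitUnder M C l) (hl : level M = 0) {a : V → Bool}
    (ha : Models a Φ₀) : a l.1 = l.2 := by
  obtain ⟨x, hx, hax⟩ := hi a ha
  by_cases hxl : x = l
  · exact hxl ▸ hax
  · have := h.zero a ha (neg x) (by rw [upTo_of_le (by omega)]; exact hu.2.2 x hx hxl)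
    exact absurd this (ne_neg_snd hax)

theorem decs_upTo_le_cons (k : ℕ) (e : Entry V) (M : Trail V) :
    decs (upTo k M) ≤ decs (upTo k (e :: M)) :=
  decs_le_of_suffix (upTo_suffix_cons k e M)

theorem SolverInv.cons_null (h : SolverInv I W Φ₀ Φ none D M) :
    SolverInv I W Φ₀ Φ none D (.null :: M) :=
  h.cons .null <| by simp [Entry.opensLevel]

variable [DecidableEq V]

theorem SolverInv.insert (h : SolverInv I W Φ₀ Φ c D M) {C : Clause V} (hv : ∀ x ∈ C, x.1 ∈ W)
    (hi : Implied Φ₀ C) : SolverInv I W Φ₀ Φ c (insert C D) M where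
  good := h.good
  subset := h.subset.trans (Finset.subset_insert _ _)
  dbVars := by
    intro E hE
    rcases Finset.mem_insert.1 hE with rfl | hE
    · exact hv
    · exact h.dbVars E hE
  dbImplied := by
    intro E hE
    rcases Finset.mem_insert.1 hE with rfl | hE
    · exact hi
    · exact h.dbImplied E hE
  conf := h.conf
  zero := h.zero

/-- The joint invariant of two solvers with variables `W` and `W'`. -/
structure PairInv (I W W' : Finset V) (Φ₀ Φ Φ' : Formula V) (c : Option (Clause V)) (D : Formula V)
    (M : Trail V) (c' : Option (Clause V)) (D' : Formula V) (M' : Trail V) : Prop where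
  left : SolverInv I W Φ₀ Φ c D M
  right : SolverInv I W' Φ₀ Φ' c' D' M'
  sync : proj I M = proj I M'
  ext : ∀ l, .ext l ∈ M → .ext l ∉ M'
  level_le : ∀ k, min k (level M) ≤ decs (upTo k M) + decs (upTo k M')
  conf : c = none ∨ c' = none

variable {W' : Finset V} {Φ' : Formula V} {c' : Option (Clause V)} {D' : Formula V} {M' : Trail V}

theorem PairInv.symm (h : PairInv I W W' Φ₀ Φ Φ' c D M c' D' M') :
    PairInv I W' W Φ₀ Φ' Φ c' D' M' c D M where
  left := h.right
  right := h.left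
  sync := h.sync.symm
  ext := fun l hl hl' => h.ext l hl' hl
  level_le := fun k => by
    have := h.level_le k
    rw [level_eq_of_proj_eq h.sync] at this
    omega
  conf := h.conf.symm

theorem PairInv.level_eq (h : PairInv I W W' Φ₀ Φ Φ' c D M c' D' M') : level M = level M' :=
  level_eq_of_proj_eq h.sync

theorem PairInv.mem_lits_upTo (h : PairInv I W W' Φ₀ Φ Φ' c D M c' D' M') {l : Lit V}
    (hl : l.1 ∈ I) (k : ℕ) : l ∈ lits (SpecSMS.upTo k M) ↔ l ∈ lits (SpecSMS.upTo k M') :=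
  mem_lits_iff_of_proj_eq (proj_upTo_eq h.sync k) hl

theorem PairInv.mem_lits (h : PairInv I W W' Φ₀ Φ Φ' c D M c' D' M') {l : Lit V}
    (hl : l.1 ∈ I) : l ∈ lits M ↔ l ∈ lits M' :=
  mem_lits_iff_of_proj_eq h.sync hl

theorem PairInv.unassigned (h : PairInv I W W' Φ₀ Φ Φ' c D M c' D' M') {l : Lit V}
    (hl : l.1 ∈ I) (hu : Unassigned M l) : Unassigned M' l := by
  rwa [Unassigned, ← h.mem_lits hl, ← h.mem_lits (l := neg l) hl]

theorem PairInv.falsified_upTo (h : PairInv I W W' Φ₀ Φ Φ' c D M c' D' M') {C : Clause V}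
    (hC : Shared I C) {k : ℕ} (hf : Falsified (SpecSMS.upTo k M) C) :
    Falsified (SpecSMS.upTo k M') C :=
  fun x hx => (h.mem_lits_upTo (l := neg x) (hC x hx) k).1 (hf x hx)

theorem PairInv.falsified (h : PairInv I W W' Φ₀ Φ Φ' c D M c' D' M') {C : Clause V}
    (hC : Shared I C) (hf : Falsified M C) : Falsified M' C :=
  fun x hx => (h.mem_lits (l := neg x) (hC x hx)).1 (hf x hx)

theorem PairInv.upTo (h : PairInv I W W' Φ₀ Φ Φ' c D M c' D' M') (k : ℕ) :
    PairInv I W W' Φ₀ Φ Φ' none D (upTo k M) none D' (upTo k M') where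
  left := h.left.upTo k
  right := h.right.upTo k
  sync := proj_upTo_eq h.sync k
  ext := fun l hl hl' => h.ext l ((upTo_suffix _ _).subset hl) ((upTo_suffix _ _).subset hl')
  level_le := fun k' => by
    have := h.level_le (min k' k)
    rw [upTo_upTo, upTo_upTo, level_upTo]
    omega
  conf := .inl rfl

theorem PairInv.setConf (h : PairInv I W W' Φ₀ Φ Φ' c D M c' D' M') {c₁ c₁' : Option (Clause V)}
    (hc : ∀ C, c₁ = some C → Falsified M C ∧ Implied Φ₀ C)
    (hc' : ∀ C, c₁' = some C → Falsified M' C ∧ Implied Φ₀ C) (h1 : c₁ = none ∨ c₁' = none) :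
    PairInv I W W' Φ₀ Φ Φ' c₁ D M c₁' D' M' :=
  { h with left := h.left.setConf hc, right := h.right.setConf hc', conf := h1 }

theorem PairInv.setConf_left (h : PairInv I W W' Φ₀ Φ Φ' c D M c' D' M') {C : Clause V}
    (hf : Falsified M C) (hi : Implied Φ₀ C) :
    PairInv I W W' Φ₀ Φ Φ' (some C) D M none D' M' :=
  h.setConf (by rintro _ ⟨⟩; exact ⟨hf, hi⟩) (by simp) (.inr rfl)

theorem PairInv.insert_left (h : PairInv I W W' Φ₀ Φ Φ' c D M c' D' M') {C : Clause V}
    (hv : ∀ x ∈ C, x.1 ∈ W) (hi : Implied Φ₀ C) :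
    PairInv I W W' Φ₀ Φ Φ' c (insert C D) M c' D' M' :=
  { h with left := h.left.insert hv hi }

theorem PairInv.prop_left (h : PairInv I W W' Φ₀ Φ Φ' none D M none D' M') {C : Clause V}
    {l : Lit V} (hC : C ∈ D) (hu : UnitUnder M C l) (hl : l.1 ∉ I) :
    PairInv I W W' Φ₀ Φ Φ' none D (.prop l C :: M) none D' M' where
  left := h.left.cons (.prop (h.left.dbVars C hC l hu.1) hu (h.left.dbImplied C hC)) <| by
    rintro a ha h0 - x ⟨⟩
    exact h.left.unit_true (h.left.dbImplied C hC) hu h0 ha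
  right := h.right
  sync := by
    rw [proj_cons, ← h.sync]
    simp [Entry.proj, Entry.lit?, Entry.opensLevel, hl]
  ext := by
    intro x hx
    exact h.ext x (by simpa using hx)
  level_le := fun k => by
    have := h.level_le k
    have := decs_upTo_le_cons k (.prop l C) M
    rw [level_cons]
    simp [Entry.opensLevel]
    omega
  conf := .inl rfl

theorem PairInv.prop_shared (h : PairInv I W W' Φ₀ Φ Φ' none D M none D' M') (hI : I ⊆ W')
    {C : Clause V} {l : Lit V} (hC : C ∈ D) (hu : UnitUnder M C l) (hl : l.1 ∈ I) {e : Entry V}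
    (he : e = .ext l ∨ ∃ E ∈ D, UnitUnder M' E l ∧ e = .prop l E) :
    PairInv I W W' Φ₀ Φ Φ' none D (.prop l C :: M) none D' (e :: M') where
  left := h.left.cons (.prop (h.left.dbVars C hC l hu.1) hu (h.left.dbImplied C hC)) <| by
    rintro a ha h0 - x ⟨⟩
    exact h.left.unit_true (h.left.dbImplied C hC) hu h0 ha
  right := by
    have hel : e.lit? = some l := by rcases he with rfl | ⟨E, -, -, rfl⟩ <;> rfl
    refine h.right.cons ?_ ?_
    · rcases he with rfl | ⟨E, hE, hEu, rfl⟩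
      · exact .of_ext (hI hl) hl (h.unassigned hl hu.2.1)
      · exact .prop (hI hl) hEu (h.left.dbImplied E hE)
    -- At level 0 the copied literal is true in all models because of `C` in the first solver; this
    -- covers external justifications as well, the levels of the trails being equal.
    · intro a ha h0 _ x hx
      rw [hel] at hx
      cases hx
      exact h.left.unit_true (h.left.dbImplied C hC) hu (h.level_eq.trans h0) ha
  sync := by
    rw [proj_cons, proj_cons, ← h.sync]
    rcases he with rfl | ⟨E, -, -, rfl⟩ <;> simp [Entry.proj, Entry.lit?, Entry.opensLevel]
  ext := by
    intro x hx
    replace hx : .ext x ∈ M := by simpa using hx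
    have h1 := h.ext x hx
    rcases he with rfl | ⟨E, -, -, rfl⟩
    · simp only [List.mem_cons, h1, or_false, Entry.ext.injEq]
      rintro rfl
      exact hu.2.1.1 ⟨.ext _, hx, rfl⟩
    · simpa using h1
  level_le := fun k => by
    have := h.level_le k
    have := decs_upTo_le_cons k (.prop l C) M
    have := decs_upTo_le_cons k e M'
    rw [level_cons]
    simp [Entry.opensLevel]
    omega
  conf := .inl rfl

/-- The new level is accounted for by the decision on `M`; the other trail opens the same level with
a null literal and gains no decision. -/
theorem PairInv.level_le_cons (h : PairInv I W W' Φ₀ Φ Φ' c D M c' D' M') {l : Lit V}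
    {N : Trail V} (hN : N = .null :: M' ∨ N = .ext l :: .null :: M') (k : ℕ) :
    min k (level (.decision l :: M)) ≤
      decs (SpecSMS.upTo k (.decision l :: M)) + decs (SpecSMS.upTo k N) := by
  have hl : level (.decision l :: M) = level M + 1 := by simp [level_cons, Entry.opensLevel]
  by_cases hk : k ≤ level M
  · rw [upTo_cons_of_lt (by omega)]
    have h1 : decs (SpecSMS.upTo k M') ≤ decs (SpecSMS.upTo k N) := by
      rcases hN with rfl | rfl
      · exact decs_upTo_le_cons _ _ _
      · exact (decs_upTo_le_cons _ _ _).trans (decs_upTo_le_cons _ _ _)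
    have := h.level_le k
    omega
  · have h0 := h.level_le k
    have h1 := h.level_eq
    rw [upTo_of_le (by omega), upTo_of_le (by omega)] at h0
    rw [upTo_of_le (by omega), upTo_of_le (M := N)]
    · have : decs N = decs M' := by rcases hN with rfl | rfl <;> simp
      rw [decs_decision]
      omega
    · rcases hN with rfl | rfl <;> simp [level_cons, Entry.opensLevel] <;> omega

theorem PairInv.decide_left (h : PairInv I W W' Φ₀ Φ Φ' none D M none D' M') {l : Lit V}
    (hl : l.1 ∈ W) (hI : l.1 ∉ I) (hu : Unassigned M l) :
    PairInv I W W' Φ₀ Φ Φ' none D (.decision l :: M) none D' (.null :: M') where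
  left := h.left.cons (.decision hl hu) <| by simp [Entry.opensLevel]
  right := h.right.cons_null
  sync := by
    rw [proj_cons, proj_cons, ← h.sync]
    simp [Entry.proj, Entry.lit?, Entry.opensLevel, hI]
  ext := by
    intro x hx
    simpa using h.ext x (by simpa using hx)
  level_le := h.level_le_cons (.inl rfl)
  conf := .inl rfl

theorem PairInv.decide_shared_left (h : PairInv I W W' Φ₀ Φ Φ' none D M none D' M')
    (hW : I ⊆ W) (hW' : I ⊆ W') {l : Lit V} (hI : l.1 ∈ I) (hu : Unassigned M l) :
    PairInv I W W' Φ₀ Φ Φ' none D (.decision l :: M) none D' (.ext l :: .null :: M') where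
  left := h.left.cons (.decision (hW hI) hu) <| by simp [Entry.opensLevel]
  right := by
    refine h.right.cons_null.cons (.of_ext (hW' hI) hI ?_) ?_
    · simpa [Unassigned, mem_lits_cons, Entry.lit?] using h.unassigned hI hu
    · intro a _ h0
      simp [level_cons, Entry.opensLevel] at h0
  sync := by
    rw [proj_cons, proj_cons, proj_cons, ← h.sync]
    simp [Entry.proj, Entry.lit?, Entry.opensLevel, hI]
  ext := by
    intro x hx
    replace hx : .ext x ∈ M := by simpa using hx
    simp only [List.mem_cons, h.ext x hx, or_false, Entry.ext.injEq, reduceCtorEq]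
    rintro rfl
    exact hu.1 ⟨.ext _, hx, rfl⟩
  level_le := h.level_le_cons (.inr rfl)
  conf := .inl rfl

/-- A clause obtained by final analysis can serve as a reason in the other solver. -/
theorem PairInv.reason_of_analyzeFinal (h : PairInv I W W' Φ₀ Φ Φ' c D M c' D' M') {l : Lit V}
    {E : Clause V} (hE : AnalyzeFinal I M' l E) {N : Trail V} (hN : .ext l :: N <:+ M) :
    l ∈ E ∧ ∀ x ∈ E, x ≠ l → neg x ∈ lits N := by
  obtain ⟨hs, R, hR, hres⟩ := hE
  obtain ⟨N', hN'⟩ := exists_suffix_of_mem hR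
  obtain ⟨h1, h2⟩ := hres.reason h.right.good hN'
  refine ⟨h1, fun x hx hxl => ?_⟩
  have hl := h.left.good.ext_mem (hN.mem List.mem_cons_self)
  refine mem_lits_of_proj_eq h.left.good h.right.good h.sync (l := l) ?_ ?_ hN hN' hl rfl rfl
    (hs x hx) (h2 x hx hxl) <;> simp [Entry.proj, Entry.lit?, Entry.opensLevel, hl]

theorem AnalyzeFinal.implied (h : SolverInv I W Φ₀ Φ c D M) {l : Lit V} {E : Clause V}
    (hE : AnalyzeFinal I M l E) : Implied Φ₀ E := by
  obtain ⟨-, R, hR, hres⟩ := hE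
  obtain ⟨N, hN⟩ := exists_suffix_of_mem hR
  exact hres.implied h.good ((h.good _ N hN).reason l R rfl).2.2

theorem PairInv.setReason_left (h : PairInv I W W' Φ₀ Φ Φ' c D M c' D' M') (hW : I ⊆ W)
    {l : Lit V} {E : Clause V} (hE : AnalyzeFinal I M' l E) :
    PairInv I W W' Φ₀ Φ Φ' c (insert E D) (setReason l E M) c' D' M' where
  left := by
    have hi := hE.implied h.right
    have h1 := h.left.insert (C := E) (fun x hx => hW (hE.1 x hx)) hi
    exact { h1 with
      good := h.left.good.setReason (fun N hN => h.reason_of_analyzeFinal hE hN) hi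
      conf := by simpa [Falsified] using h1.conf
      zero := by simpa [upTo_setReason] using h1.zero }
  right := h.right
  sync := by rw [proj_setReason, h.sync]
  ext := fun x hx => h.ext x (ext_mem_of_setReason hx)
  level_le := by simpa [upTo_setReason] using h.level_le
  conf := h.conf

theorem SymStep.pairInv {a b a' b' : Solver V} (h : SymStep I a b a' b') (hW : I ⊆ W)
    (hW' : I ⊆ W') (hp : PairInv I W W' Φ₀ Φ Φ' a.conf a.db a.trail b.conf b.db b.trail) :
    PairInv I W W' Φ₀ Φ Φ' a'.conf a'.db a'.trail b'.conf b'.db b'.trail := by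
  cases h with
  | prop hC hu hl => exact hp.prop_left hC hu hl
  | propS hC hu hl hE hEI hEu => exact hp.prop_shared hW' hC hu hl (.inr ⟨_, hE, hEu, rfl⟩)
  | propD hC hu hl hE => exact hp.prop_shared hW' hC hu hl (.inl rfl)
  | conflict hC hf => exact hp.setConf_left hf (hp.left.dbImplied _ hC)
  | explain hC hR =>
    obtain ⟨h1, h2⟩ := hp.left.conf _ rfl
    obtain ⟨N, hN⟩ := exists_suffix_of_mem hR
    exact hp.setConf_left (h1.resolvent hp.left.good hR)
      (h2.resolvent _ ((hp.left.good _ N hN).reason _ _ rfl).2.2)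
  | reason hC hl hc => exact hp.setReason_left hW hc

end PairInv

/-! ### Invariants of the search modes -/

section ModeInv

variable {V : Type*}

theorem FullSat.mono {W : Finset V} {M N : Trail V} {Φ Ψ : Formula V} (h : FullSat W M Φ)
    (hl : lits M ⊆ lits N) (hs : Ψ ⊆ Φ) : FullSat W N Ψ :=
  ⟨fun v hv => (h.1 v hv).imp fun _ hb => hl hb,
    fun C hC => (h.2 C (hs hC)).imp fun _ hx => ⟨hx.1, hl hx.2⟩⟩

/-- The levels up to `i` have been opened by the main solver, and those above `i` by the secondary
solver. -/
structure Speculating (i : ℕ) (M M' : Trail V) : Prop where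
  le_level : i ≤ level M'
  decs_left : decs (upTo i M) = 0
  decs_right : decs M' ≤ decs (upTo i M')

/-- The levels up to `i` have been opened by the main solver, and those between `i` and `j` by the
secondary solver. -/
structure Validating (i j : ℕ) (M M' : Trail V) : Prop where
  le : i ≤ j
  le_level : j ≤ level M'
  decs_left : decs (upTo i M) = 0
  decs_right : decs (upTo j M') ≤ decs (upTo i M')

/-- What holds of the secondary solver `s` and the main solver `m` according to their modes. -/
inductive ModeInv (Ws Wm : Finset V) (Φs Φm : Formula V) (s m : Solver V) : Prop
  | normal (hs : s.mode = .P) (hm : m.mode = .D 0) (hd : decs s.trail = 0)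
  | speculate {i : ℕ} (hs : s.mode = .D i) (hm : m.mode = .P) (h : Speculating i s.trail m.trail)
  | finish {i : ℕ} (hs : s.mode = .D i) (hm : m.mode = .F) (h : Speculating i s.trail m.trail)
      (hf : FullSat Wm (upTo i m.trail) Φm) (hc : m.conf = none)
      (ht : FullSat Wm (upTo i m.trail) m.db ∨
        ∃ C, s.conf = some C ∧ Falsified (upTo i s.trail) C)
  | validate {i j : ℕ} (hs : s.mode = .F) (hm : m.mode = .DV i j)
      (h : Validating i j s.trail m.trail) (hf : FullSat Ws (upTo j s.trail) s.db)
      (hc : s.conf = none)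
  | final (hs : s.mode = .F) (hm : m.mode = .F) (hfs : FullSat Ws s.trail Φs)
      (hfm : FullSat Wm m.trail Φm)

/-- The trail `N` extends `M` without new levels, possibly with other reasons. -/
structure TrailLe (M N : Trail V) : Prop where
  level : level N = level M
  decs : ∀ k, decs (upTo k N) = decs (upTo k M)
  lits : ∀ k, lits (upTo k M) ⊆ lits (upTo k N)

theorem TrailLe.refl (M : Trail V) : TrailLe M M := ⟨rfl, fun _ => rfl, fun _ => subset_rfl⟩

theorem TrailLe.setReason (l : Lit V) (c : Clause V) (M : Trail V) :
    TrailLe M (setReason l c M) :=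
  ⟨by simp, fun k => by simp [upTo_setReason], fun k => by simp [upTo_setReason]⟩

theorem TrailLe.cons {e : Entry V} (he : e.opensLevel = false) (M : Trail V) :
    TrailLe M (e :: M) where
  level := by simp [level_cons, he]
  decs := fun k => by
    by_cases h : SpecSMS.level (e :: M) ≤ k
    · rw [upTo_of_le h, upTo_of_le ((level_le_level_cons e M).trans h)]
      cases e <;> simp_all [Entry.opensLevel]
    · rw [upTo_cons_of_lt (by omega)]
  lits := fun k => lits_upTo_subset_cons k e M

theorem TrailLe.lits_subset {M N : Trail V} (h : TrailLe M N) :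
    SpecSMS.lits M ⊆ SpecSMS.lits N := by
  have := h.lits (SpecSMS.level M)
  rwa [upTo_of_le le_rfl, upTo_of_le h.level.le] at this

theorem TrailLe.decs_eq {M N : Trail V} (h : TrailLe M N) : SpecSMS.decs N = SpecSMS.decs M := by
  have := h.decs (SpecSMS.level M)
  rwa [upTo_of_le le_rfl, upTo_of_le h.level.le] at this

theorem Speculating.mono {i : ℕ} {M M' N N' : Trail V} (h : Speculating i M M')
    (hN : TrailLe M N) (hN' : TrailLe M' N') : Speculating i N N' :=
  ⟨hN'.level ▸ h.le_level, by rw [hN.decs, h.decs_left],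
    by rw [hN'.decs, hN'.decs_eq]; exact h.decs_right⟩

theorem Validating.mono {i j : ℕ} {M M' N N' : Trail V} (h : Validating i j M M')
    (hN : TrailLe M N) (hN' : TrailLe M' N') : Validating i j N N' :=
  ⟨h.le, hN'.level ▸ h.le_level, by rw [hN.decs, h.decs_left],
    by rw [hN'.decs, hN'.decs]; exact h.decs_right⟩

theorem upTo_cons_of_opensLevel {k : ℕ} {e : Entry V} {M : Trail V} (hk : k ≤ level M)
    (he : e.opensLevel = true) : upTo k (e :: M) = upTo k M :=
  upTo_cons_of_lt (by rw [level_cons, he]; simp; omega)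

theorem Speculating.decide {i : ℕ} {M M' : Trail V} (h : Speculating i M M')
    (hl : level M = level M') (l : Lit V) : Speculating i (.decision l :: M) (.null :: M') where
  le_level := h.le_level.trans (level_le_level_cons _ _)
  decs_left := by
    rw [upTo_cons_of_opensLevel (hl ▸ h.le_level) rfl]
    exact h.decs_left
  decs_right := by
    rw [upTo_cons_of_opensLevel h.le_level rfl, decs_null]
    exact h.decs_right

theorem Speculating.upTo {i k : ℕ} {M M' : Trail V} (h : Speculating i M M') (hk : i ≤ k) :
    Speculating i (upTo k M) (upTo k M') where
  le_level := by rw [level_upTo]; exact le_min hk h.le_level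
  decs_left := by rw [upTo_upTo, min_eq_left hk, h.decs_left]
  decs_right := by
    rw [upTo_upTo, min_eq_left hk]
    exact (decs_le_of_suffix (upTo_suffix _ _)).trans h.decs_right

theorem Validating.upTo {i j k : ℕ} {M M' : Trail V} (h : Validating i j M M') (hk : j ≤ k) :
    Validating i j (upTo k M) (upTo k M') where
  le := h.le
  le_level := by rw [level_upTo]; exact le_min hk h.le_level
  decs_left := by rw [upTo_upTo, min_eq_left (h.le.trans hk), h.decs_left]
  decs_right := by
    rw [upTo_upTo, upTo_upTo, min_eq_left hk, min_eq_left (h.le.trans hk)]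
    exact h.decs_right

theorem Validating.decide {i j : ℕ} {M M' N : Trail V} (h : Validating i j M M')
    (hN : SpecSMS.upTo i N = SpecSMS.upTo i M) (l : Lit V) : Validating i j N (.decision l :: M') where
  le := h.le
  le_level := h.le_level.trans (level_le_level_cons _ _)
  decs_left := by rw [hN, h.decs_left]
  decs_right := by
    rw [upTo_cons_of_opensLevel h.le_level rfl,
      upTo_cons_of_opensLevel (h.le.trans h.le_level) rfl]
    exact h.decs_right

theorem upTo_ext_null {k : ℕ} {M : Trail V} (hk : k ≤ level M) (l : Lit V) :
    upTo k (.ext l :: .null :: M) = upTo k M := by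
  rw [upTo_cons_of_lt, upTo_cons_of_opensLevel hk rfl]
  simp [level_cons, Entry.opensLevel]
  omega

theorem Falsified.not_unitUnder {M N : Trail V} {C : Clause V} (h : Falsified M C)
    (hs : lits M ⊆ lits N) (l : Lit V) : ¬ UnitUnder N C l :=
  fun hu => hu.2.1.2 (hs (h l hu.1))

variable {Ws Wm I W : Finset V} {Φs Φm Φ₀ Φ : Formula V}

theorem ModeInv.of_P {s m : Solver V} (h : ModeInv Ws Wm Φs Φm s m) (hs : s.mode = .P) :
    m.mode = .D 0 ∧ decs s.trail = 0 := by
  rcases h with ⟨h1, h2, hd⟩ | ⟨h1, h2, hd⟩ | ⟨h1, h2, hd, hf, hc, ht⟩ |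
    ⟨h1, h2, hd, hf, hc⟩ | ⟨h1, h2, hf, hf'⟩ <;> simp_all

theorem ModeInv.of_D {s m : Solver V} (h : ModeInv Ws Wm Φs Φm s m) {i : ℕ} (hs : s.mode = .D i) :
    Speculating i s.trail m.trail ∧ (m.mode = .P ∨ m.mode = .F ∧
      FullSat Wm (upTo i m.trail) Φm ∧ m.conf = none ∧ (FullSat Wm (upTo i m.trail) m.db ∨
        ∃ C, s.conf = some C ∧ Falsified (upTo i s.trail) C)) := by
  rcases h with ⟨h1, h2, hd⟩ | ⟨h1, h2, hd⟩ | ⟨h1, h2, hd, hf, hc, ht⟩ |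
    ⟨h1, h2, hd, hf, hc⟩ | ⟨h1, h2, hf, hf'⟩ <;> rw [hs] at h1 <;> cases h1
  · exact ⟨hd, .inl h2⟩
  · exact ⟨hd, .inr ⟨h2, hf, hc, ht⟩⟩

theorem ModeInv.of_DV {s m : Solver V} (h : ModeInv Ws Wm Φs Φm s m) {i j : ℕ}
    (hm : m.mode = .DV i j) : s.mode = .F ∧ Validating i j s.trail m.trail ∧
      FullSat Ws (upTo j s.trail) s.db ∧ s.conf = none := by
  rcases h with ⟨h1, h2, hd⟩ | ⟨h1, h2, hd⟩ | ⟨h1, h2, hd, hf, hc, ht⟩ |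
    ⟨h1, h2, hd, hf, hc⟩ | ⟨h1, h2, hf, hf'⟩ <;> rw [hm] at h2 <;> cases h2
  exact ⟨h1, hd, hf, hc⟩

/-- A model satisfies some literal of `C`, whose complement is a level-0 literal and therefore also
holds. -/
theorem SolverInv.implied_empty {c : Option (Clause V)} {D : Formula V} {M : Trail V}
    (h : SolverInv I W Φ₀ Φ c D M) {C : Clause V} (hi : Implied Φ₀ C)
    (hf : Falsified (SpecSMS.upTo 0 M) C) : Implied Φ₀ ∅ := by
  intro a ha
  obtain ⟨l, hl, hal⟩ := hi a ha
  exact absurd (h.zero a ha _ (hf l hl)) (ne_neg_snd hal)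

variable [DecidableEq V]

/-! ### Preservation of the invariant by the rules -/

theorem SymStep.effect {a b a' b' : Solver V} (h : SymStep I a b a' b') :
    a'.mode = a.mode ∧ b'.mode = b.mode ∧ b'.conf = b.conf ∧ b'.db = b.db ∧ b.conf = none ∧
      TrailLe a.trail a'.trail ∧ TrailLe b.trail b'.trail := by
  cases h with
  | prop => exact ⟨rfl, rfl, rfl, rfl, rfl, .cons rfl _, .refl _⟩
  | propS => exact ⟨rfl, rfl, rfl, rfl, rfl, .cons rfl _, .cons rfl _⟩
  | propD => exact ⟨rfl, rfl, rfl, rfl, rfl, .cons rfl _, .cons rfl _⟩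
  | conflict => exact ⟨rfl, rfl, rfl, rfl, rfl, .refl _, .refl _⟩
  | explain => exact ⟨rfl, rfl, rfl, rfl, rfl, .refl _, .refl _⟩
  | reason => exact ⟨rfl, rfl, rfl, rfl, rfl, .setReason _ _ _, .refl _⟩

/-- A solver with a full satisfying assignment and without conflict neither propagates nor finds a
conflict. -/
theorem FullSat.not_symStep {a b a' b' : Solver V} (hf : FullSat W a.trail a.db)
    (hg : GoodTrail I W Φ₀ a.trail) (hv : ∀ C ∈ a.db, ∀ x ∈ C, x.1 ∈ W) (hc : a.conf = none) :
    ¬ SymStep I a b a' b' := by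
  have key : ∀ C ∈ a.db, ∀ l, ¬ UnitUnder a.trail C l := by
    rintro C hC ⟨v, p⟩ hu
    obtain ⟨q, hq⟩ := hf.1 v (hv C hC _ hu.1)
    have h2 := hu.2.1
    cases p <;> cases q <;> simp_all [Unassigned, neg]
  intro h
  cases h with
  | prop hC hu => exact key _ hC _ hu
  | propS hC hu => exact key _ hC _ hu
  | propD hC hu => exact key _ hC _ hu
  | conflict hC hff =>
    obtain ⟨l, hl, hlM⟩ := hf.2 _ hC
    exact hg.neg_notMem hlM (hff l hl)
  | explain => simp at hc
  | reason => simp at hc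

/-- Explaining a literal of level at most `k` brings in literals that were false before it, so
conflict analysis does not leave these levels. This preserves the second alternative of
`ModeInv.finish`. -/
theorem SymStep.falsified_upTo {a b a' b' : Solver V} (h : SymStep I a b a' b')
    (hg : GoodTrail I W Φ₀ a.trail) {k : ℕ} {C : Clause V} (hC : a.conf = some C)
    (hf : Falsified (upTo k a.trail) C) :
    ∃ C', a'.conf = some C' ∧ Falsified (upTo k a'.trail) C' := by
  cases h with
  | prop => simp at hC
  | propS => simp at hC
  | propD => simp at hC
  | conflict => simp at hC
  | @explain _ _ _ _ _ _ _ R l hl hR =>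
    cases hC
    refine ⟨_, rfl, hf.resolvent (hg.suffix (upTo_suffix _ _)) ?_⟩
    have := hf _ hl
    rw [lit_neg_neg] at this
    exact hg.mem_of_suffix (upTo_suffix _ _) hR rfl this
  | reason =>
    cases hC
    exact ⟨_, rfl, by simpa [Falsified, upTo_setReason] using hf⟩

/-- The joint invariant of the secondary solver `s` and the main solver `m`. -/
structure RunInv (I Ws Wm : Finset V) (Φ₀ Φs Φm : Formula V) (s m : Solver V) : Prop where
  pair : PairInv I Ws Wm Φ₀ Φs Φm s.conf s.db s.trail m.conf m.db m.trail
  mode : ModeInv Ws Wm Φs Φm s m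

theorem RunInv.symStep_left {s m s' m' : Solver V} (hW : I ⊆ Ws) (hW' : I ⊆ Wm)
    (h : RunInv I Ws Wm Φ₀ Φs Φm s m) (hs : SymStep I s m s' m') :
    RunInv I Ws Wm Φ₀ Φs Φm s' m' := by
  refine ⟨hs.pairInv hW hW' h.pair, ?_⟩
  obtain ⟨e1, e2, e3, e4, e5, t1, t2⟩ := hs.effect
  rcases h.mode with ⟨h1, h2, hd⟩ | ⟨h1, h2, hd⟩ | ⟨h1, h2, hd, hf, hc, ht⟩ |
    ⟨h1, h2, hd, hf, hc⟩ | ⟨h1, h2, hf, hf'⟩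
  · exact .normal (e1.trans h1) (e2.trans h2) (t1.decs_eq.trans hd)
  · exact .speculate (e1.trans h1) (e2.trans h2) (hd.mono t1 t2)
  · refine .finish (e1.trans h1) (e2.trans h2) (hd.mono t1 t2) (hf.mono (t2.lits _) subset_rfl)
      (e3.trans hc) ?_
    rcases ht with ht | ⟨C, hC, hCf⟩
    · exact .inl (ht.mono (t2.lits _) e4.subset)
    · exact .inr (hs.falsified_upTo h.pair.left.good hC hCf)
  -- During validation the secondary solver has a full satisfying assignment to its whole database,
  -- so it cannot act.
  · exact absurd hs ((hf.mono (lits_upTo_subset _ _) subset_rfl).not_symStep h.pair.left.good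
      h.pair.left.dbVars hc)
  · exact .final (e1.trans h1) (e2.trans h2) (hf.mono t1.lits_subset subset_rfl)
      (hf'.mono t2.lits_subset subset_rfl)

theorem RunInv.symStep_right {s m s' m' : Solver V} (hW : I ⊆ Ws) (hW' : I ⊆ Wm)
    (h : RunInv I Ws Wm Φ₀ Φs Φm s m) (hs : SymStep I m s m' s') :
    RunInv I Ws Wm Φ₀ Φs Φm s' m' := by
  refine ⟨(hs.pairInv hW' hW h.pair.symm).symm, ?_⟩
  obtain ⟨e1, e2, e3, e4, e5, t1, t2⟩ := hs.effect
  rcases h.mode with ⟨h1, h2, hd⟩ | ⟨h1, h2, hd⟩ | ⟨h1, h2, hd, hf, hc, ht⟩ |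
    ⟨h1, h2, hd, hf, hc⟩ | ⟨h1, h2, hf, hf'⟩
  · exact .normal (e2.trans h1) (e1.trans h2) (t2.decs_eq.trans hd)
  · exact .speculate (e2.trans h1) (e1.trans h2) (hd.mono t2 t1)
  -- The finished main solver cannot act: either its database is satisfied, or the secondary solver
  -- has a conflict, which blocks it.
  · rcases ht with ht | ⟨C, hC, hCf⟩
    · exact absurd hs ((ht.mono (lits_upTo_subset _ _) subset_rfl).not_symStep
        h.pair.right.good h.pair.right.dbVars hc)
    · rw [e5] at hC
      cases hC
  · exact .validate (e2.trans h1) (e1.trans h2) (hd.mono t2 t1)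
      (hf.mono (t2.lits _) e4.subset) (e3.trans hc)
  · exact .final (e2.trans h1) (e1.trans h2) (hf.mono t2.lits_subset subset_rfl)
      (hf'.mono t1.lits_subset subset_rfl)

/-- An interface literal on the trail of a solver belongs to the levels at which the other solver
has assigned all its variables. -/
theorem PairInv.mem_upTo_of_fullSat {W W' : Finset V} {Φ' Ψ : Formula V}
    {c c' : Option (Clause V)} {D D' : Formula V} {M M' : Trail V}
    (h : PairInv I W W' Φ₀ Φ Φ' c D M c' D' M') (hW' : I ⊆ W') {k : ℕ}
    (hf : FullSat W' (SpecSMS.upTo k M') Ψ) {l : Lit V} (hI : l.1 ∈ I) (hl : l ∈ lits M') :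
    l ∈ lits (SpecSMS.upTo k M') := by
  obtain ⟨b, hb⟩ := hf.1 l.1 (hW' hI)
  rcases eq_or_eq_neg (l := l) (r := (l.1, b)) rfl with hr | hr
  · rwa [← hr]
  · rw [hr] at hb
    exact absurd (lits_upTo_subset _ _ hb) (h.right.good.neg_notMem hl)

/-- All interface variables are assigned up to level `k` by the other solver, so nothing above `k`
can contribute to a shared conflict. -/
theorem PairInv.falsified_upTo_of_fullSat {W W' : Finset V} {Φ' Ψ : Formula V}
    {c c' : Option (Clause V)} {D D' : Formula V} {M M' : Trail V}
    (h : PairInv I W W' Φ₀ Φ Φ' c D M c' D' M') (hW' : I ⊆ W') {k : ℕ}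
    (hf : FullSat W' (SpecSMS.upTo k M') Ψ) {C : Clause V} (hC : Shared I C)
    (hCf : Falsified M C) : Falsified (SpecSMS.upTo k M) C := by
  intro x hx
  have hI : (neg x).1 ∈ I := hC x hx
  rw [h.mem_lits_upTo hI]
  exact h.mem_upTo_of_fullSat hW' hf hI ((h.mem_lits hI).1 (hCf x hx))

/-- The invariant of a configuration. -/
def Config.Inv (I Ws Wm : Finset V) (Φ₀ Φs Φm : Formula V) : Config V → Prop
  | .run s m => RunInv I Ws Wm Φ₀ Φs Φm s m
  | .unsat => ¬ Satisfiable Φ₀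

/-- The common target of the three refinements. Cutting at `i` removes all decisions of the
secondary solver, and what follows is an ordinary shared decision of the main solver, whence the
exchange of roles. -/
theorem RunInv.refine {i : ℕ} {cs cm : Option (Clause V)} {Ds Dm : Formula V} {Ms Mm : Trail V}
    (h : PairInv I Ws Wm Φ₀ Φs Φm cs Ds Ms cm Dm Mm) (hW : I ⊆ Ws) (hW' : I ⊆ Wm)
    (hd : decs (upTo i Ms) = 0) {l r : Lit V} (hl : l.1 ∈ I) (hu : Unassigned (upTo i Mm) l)
    (hr : r.1 = l.1) :
    RunInv I Ws Wm Φ₀ Φs Φm ⟨.P, none, Ds, .ext r :: .null :: upTo i Ms⟩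
      ⟨.D 0, none, Dm, .decision r :: upTo i Mm⟩ := by
  refine ⟨((h.upTo i).symm.decide_shared_left hW' hW (hr ▸ hl) ?_).symm, .normal rfl rfl ?_⟩
  · rcases eq_or_eq_neg hr with rfl | rfl
    · exact hu
    · simpa [Unassigned, and_comm] using hu
  · simpa using hd

theorem RunInv.backjump_left {i k : ℕ} {μ : Mode} {C : Clause V} {Ds Dm : Formula V}
    {Ms Mm : Trail V} (h : RunInv I Ws Wm Φ₀ Φs Φm ⟨.D i, some C, Ds, Ms⟩ ⟨μ, none, Dm, Mm⟩)
    (hik : i ≤ k) (ha : AssertingAt Ms C k) :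
    RunInv I Ws Wm Φ₀ Φs Φm ⟨.D i, none, Ds, upTo k Ms⟩ ⟨μ, none, Dm, upTo k Mm⟩ := by
  refine ⟨h.pair.upTo k, ?_⟩
  obtain ⟨hd, hm | ⟨hm, hf, hc, ht⟩⟩ := h.mode.of_D rfl
  · exact .speculate rfl hm (hd.upTo hik)
  · refine .finish rfl hm (hd.upTo hik) ?_ rfl ?_
    · simpa [upTo_upTo, min_eq_left hik] using hf
    · left
      rcases ht with ht | ⟨E, hE, hEf⟩
      · simpa [upTo_upTo, min_eq_left hik] using ht
      -- A conflict clause that is false already at level `i` is not unit at any level from `i` on,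
      -- so this back-jump is impossible.
      · cases hE
        obtain ⟨l, hl⟩ := ha
        exact absurd hl (hEf.not_unitUnder (lits_upTo_mono hik _) l)

theorem RunInv.backjump_right {i j k : ℕ} {c : Option (Clause V)} {Ds Dm : Formula V}
    {Ms Mm : Trail V} (h : RunInv I Ws Wm Φ₀ Φs Φm ⟨.F, none, Ds, Ms⟩ ⟨.DV i j, c, Dm, Mm⟩)
    (hjk : j ≤ k) :
    RunInv I Ws Wm Φ₀ Φs Φm ⟨.F, none, Ds, upTo k Ms⟩ ⟨.DV i j, none, Dm, upTo k Mm⟩ := by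
  obtain ⟨-, hd, hf, hc⟩ := h.mode.of_DV rfl
  exact ⟨h.pair.upTo k, .validate rfl rfl (hd.upTo hjk)
    (by simpa [upTo_upTo, min_eq_left hjk] using hf) rfl⟩

theorem Step.inv {c c' : Config V} (hW : I ⊆ Ws) (hW' : I ⊆ Wm) (h : Step I Ws Wm c c')
    (hc : c.Inv I Ws Wm Φ₀ Φs Φm) : c'.Inv I Ws Wm Φ₀ Φs Φm := by
  cases h with
  | sym_s h => exact RunInv.symStep_left hW hW' hc h
  | sym_m h => exact RunInv.symStep_right hW hW' hc h
  | decide_m hμ hs hm hl hI hu =>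
    obtain ⟨hp, hm⟩ := hc
    refine ⟨(hp.symm.decide_left hl hI hu).symm, ?_⟩
    rcases hm with ⟨h1, h2, hd⟩ | ⟨h1, h2, hd⟩ | ⟨h1, h2, hd, hf, hc, ht⟩ |
      ⟨h1, h2, hd, hf, hc⟩ | ⟨h1, h2, hf, hf'⟩
    · exact .normal h1 h2 (by simpa using hd)
    · cases h2; cases hμ
    · cases h2; cases hμ
    · have hj := hp.level_eq.symm ▸ hd.le_level
      refine .validate h1 h2 (hd.decide (upTo_cons_of_opensLevel (hd.le.trans hj) rfl) _) ?_ hc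
      rw [upTo_cons_of_opensLevel hj rfl]
      exact hf
    · cases h2; cases hμ
  | decide_mS hμ hs hm hl hI hu =>
    obtain ⟨hp, hm⟩ := hc
    refine ⟨(hp.symm.decide_shared_left hW' hW hI hu).symm, ?_⟩
    rcases hm with ⟨h1, h2, hd⟩ | ⟨h1, h2, hd⟩ | ⟨h1, h2, hd, hf, hc, ht⟩ |
      ⟨h1, h2, hd, hf, hc⟩ | ⟨h1, h2, hf, hf'⟩
    · exact .normal h1 h2 (by simpa using hd)
    · cases h2; cases hμ
    · cases h2; cases hμ
    · have hj := hp.level_eq.symm ▸ hd.le_level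
      refine .validate h1 h2 (hd.decide (upTo_ext_null (hd.le.trans hj) _) _) ?_ hc
      rw [upTo_ext_null hj]
      exact hf
    · cases h2; cases hμ
  | decide_s hμ hs hm hl hI hu =>
    obtain ⟨hp, hm⟩ := hc
    refine ⟨hp.decide_left hl hI hu, ?_⟩
    obtain ⟨hd, hm | ⟨hm, hf, hc, ht⟩⟩ := hm.of_D rfl
    · exact .speculate rfl hm (hd.decide hp.level_eq _)
    · refine .finish rfl hm (hd.decide hp.level_eq _) ?_ rfl (.inl ?_)
      · rw [upTo_cons_of_opensLevel hd.le_level rfl]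
        exact hf
      · rw [upTo_cons_of_opensLevel hd.le_level rfl]
        exact ht.resolve_right (by simp)
  | decide_sS hs hm hl hI hu =>
    obtain ⟨hp, hm⟩ := hc
    refine ⟨hp.decide_shared_left hW hW' hI hu, ?_⟩
    have hd := (hm.of_D rfl).1
    refine .speculate rfl rfl ⟨?_, (hd.decide hp.level_eq _).decs_left, ?_⟩
    · exact (hd.le_level.trans (level_le_level_cons _ _)).trans (level_le_level_cons _ _)
    · rw [upTo_ext_null hd.le_level]
      simpa using hd.decs_right
  | speculate hs hm =>
    obtain ⟨hp, hm⟩ := hc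
    refine ⟨hp, .speculate rfl rfl ⟨le_rfl, ?_, ?_⟩⟩
    · rw [upTo_of_le hp.level_eq.le]
      exact (hm.of_P rfl).2
    · rw [upTo_of_le le_rfl]
  | fa_m hf =>
    obtain ⟨hp, hm⟩ := hc
    refine ⟨hp, .finish rfl rfl ⟨le_rfl, ?_, ?_⟩ ?_ rfl (.inl ?_)⟩
    · rw [upTo_of_le hp.level_eq.le]
      exact (hm.of_P rfl).2
    · rw [upTo_of_le le_rfl]
    · rw [upTo_of_le le_rfl]
      exact hf.mono subset_rfl hp.right.subset
    · rw [upTo_of_le le_rfl]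
      exact hf
  | fa_s_validate hf =>
    obtain ⟨hp, hm⟩ := hc
    have hd := (hm.of_D rfl).1
    refine ⟨hp, .validate rfl rfl ⟨?_, hp.level_eq.le, hd.decs_left, ?_⟩ ?_ rfl⟩
    · exact hd.le_level.trans hp.level_eq.ge
    · rw [upTo_of_le hp.level_eq.ge]
      exact hd.decs_right
    · rw [upTo_of_le le_rfl]
      exact hf
  | fa_s_final hf =>
    obtain ⟨hp, hm⟩ := hc
    obtain ⟨hd, hm | ⟨hm, hf', hc, ht⟩⟩ := hm.of_D rfl
    · cases hm
    -- Satisfaction of the original `Φm` is what is needed here. It is recorded apart from that of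
    -- the database, which may have received a clause that is false under the trail.
    · exact ⟨hp, .final rfl rfl (hf.mono subset_rfl hp.left.subset)
        (hf'.mono (lits_upTo_subset _ _) subset_rfl)⟩
  | fa_validated hf =>
    obtain ⟨hp, hm⟩ := hc
    obtain ⟨-, hd, hf', hc⟩ := hm.of_DV rfl
    exact ⟨hp, .final rfl rfl (hf'.mono (lits_upTo_subset _ _) hp.left.subset)
      (hf.mono subset_rfl hp.right.subset)⟩
  | learn_m hμ hC =>
    obtain ⟨hp, hm⟩ := hc
    obtain ⟨h1, h2⟩ := hp.right.conf _ rfl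
    refine ⟨(hp.symm.insert_left (hp.right.vars_of_falsified h1) h2).symm, ?_⟩
    rcases hm with ⟨h1, h2, hd⟩ | ⟨h1, h2, hd⟩ | ⟨h1, h2, hd, hf, hc, ht⟩ |
      ⟨h1, h2, hd, hf, hc⟩ | ⟨h1, h2, hf, hf'⟩
    · exact .normal h1 h2 hd
    · cases h2; cases hμ
    · cases h2; cases hμ
    · exact .validate h1 h2 hd hf hc
    · cases h2; cases hμ
  | learn_s hC =>
    obtain ⟨hp, hm⟩ := hc
    obtain ⟨h1, h2⟩ := hp.left.conf _ rfl
    refine ⟨hp.insert_left (hp.left.vars_of_falsified h1) h2, ?_⟩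
    obtain ⟨hd, hm | ⟨hm, hf', hc, ht⟩⟩ := hm.of_D rfl
    · exact .speculate rfl hm hd
    · exact .finish rfl hm hd hf' hc ht
  | learn_ms hI hC =>
    obtain ⟨hp, hm⟩ := hc
    obtain ⟨h1, h2⟩ := hp.left.conf _ rfl
    refine ⟨(hp.symm.insert_left (fun x hx => hW' (hI x hx)) h2).symm, ?_⟩
    rcases hm with ⟨h1, h2, hd⟩ | ⟨h1, h2, hd⟩ | ⟨h3, h2, hd, hf, hc, ht⟩ |
      ⟨h1, h2, hd, hf, hc⟩ | ⟨h1, h2, hf, hf'⟩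
    · exact .normal h1 h2 hd
    · exact .speculate h1 h2 hd
    -- The learned clause can destroy satisfaction of the main database, but being a shared conflict
    -- it is false at level `i` already; the second alternative records this.
    · exact .finish h3 h2 hd hf hc (.inr ⟨_, rfl, hp.falsified_upTo_of_fullSat hW' hf hI h1⟩)
    · cases hc
    · exact .final h1 h2 hf hf'
  | learn_sm hI hC =>
    obtain ⟨hp, hm⟩ := hc
    obtain ⟨h1, h2⟩ := hp.right.conf _ rfl
    exact ⟨hp.insert_left (fun x hx => hW (hI x hx)) h2, .speculate rfl rfl (hm.of_D rfl).1⟩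
  | explain_ms hI hC =>
    obtain ⟨hp, hm⟩ := hc
    obtain ⟨h1, h2⟩ := hp.left.conf _ rfl
    exact ⟨(hp.symm.setConf_left (hp.falsified hI h1) h2).symm, .normal rfl rfl (hm.of_P rfl).2⟩
  | explain_sm hμ hI hC =>
    obtain ⟨hp, hm⟩ := hc
    obtain ⟨h1, h2⟩ := hp.right.conf _ rfl
    refine ⟨hp.setConf_left (hp.symm.falsified hI h1) h2, ?_⟩
    obtain ⟨hd, hm | ⟨hm, hf', hc, ht⟩⟩ := hm.of_D rfl
    · exact .speculate rfl hm hd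
    · cases hc
  | backjump_m hC hk =>
    obtain ⟨hp, hm⟩ := hc
    exact ⟨hp.upTo _, .normal rfl rfl (Nat.le_zero.1
      ((decs_le_of_suffix (upTo_suffix _ _)).trans (hm.of_P rfl).2.le))⟩
  | backtrack_m hC hk ha =>
    obtain ⟨hp, hm⟩ := hc
    exact ⟨hp.upTo _, .normal rfl rfl (Nat.le_zero.1
      ((decs_le_of_suffix (upTo_suffix _ _)).trans (hm.of_P rfl).2.le))⟩
  | backjump_s hμ hC hd hk ha => exact RunInv.backjump_left hc (by omega) ha
  | backtrack_s hμ hC hk hi ha => exact RunInv.backjump_left hc hi ha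
  | backjumpV_m hC hd hi hk ha => exact RunInv.backjump_right hc (by omega)
  | backtrackV_m hC hk hj ha => exact RunInv.backjump_right hc hj
  | backjumpVE_m hC hk hi =>
    obtain ⟨hp, hm⟩ := hc
    obtain ⟨-, hd, hf', hc⟩ := hm.of_DV rfl
    -- The jump goes below `i`, where the secondary solver has made no decision.
    exact ⟨hp.upTo _, .normal rfl rfl (Nat.le_zero.1
      ((decs_le_of_suffix (upTo_suffix_upTo hi.le _)).trans hd.decs_left.le))⟩
  | exit_s hμ hI hC hf =>
    obtain ⟨hp, hm⟩ := hc
    exact ⟨((hp.upTo _).symm.setConf_left (hp.falsified_upTo hI hf) (hp.left.conf _ rfl).2).symm,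
      .normal rfl rfl (hm.of_D rfl).1.decs_left⟩
  | exit_m hf =>
    obtain ⟨hp, hm⟩ := hc
    exact ⟨((hp.upTo _).symm.setConf_left hf (hp.right.conf _ rfl).2).symm,
      .normal rfl rfl (hm.of_D rfl).1.decs_left⟩
  | refine_s hC hl hfail hu hr =>
    obtain ⟨hp, hm⟩ := hc
    exact RunInv.refine hp hW hW' (hm.of_D rfl).1.decs_left (hp.left.good.ext_mem hl) hu hr
  | refine_sm hx hxI hxd hl hI hu hr =>
    obtain ⟨hp, hm⟩ := hc
    exact RunInv.refine hp hW hW' (hm.of_D rfl).1.decs_left hI hu hr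
  | refine_m hC hl hfail hu hr =>
    obtain ⟨hp, hm⟩ := hc
    exact RunInv.refine hp hW hW' (hm.of_DV rfl).2.1.decs_left (hp.right.good.ext_mem hl) hu hr
  | fail_s hf =>
    obtain ⟨hp, hm⟩ := hc
    have hi := hp.left.implied_empty (hp.left.conf _ rfl).2 hf
    exact ⟨(((hp.upTo _).symm.insert_left (by simp) hi).setConf_left (by simp [Falsified]) hi).symm,
      .normal rfl rfl (hm.of_D rfl).1.decs_left⟩
  | fail_m hf =>
    obtain ⟨hp, hm⟩ := hc
    rintro ⟨a, ha⟩
    obtain ⟨l, hl, -⟩ := hp.right.implied_empty (hp.right.conf _ rfl).2 hf a ha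
    simp at hl

theorem initial_inv (Φs Φm : Formula V) (hs : vars Φs ⊆ Ws) (hm : vars Φm ⊆ Wm) :
    (initial Φs Φm).Inv I Ws Wm (Φs ∪ Φm) Φs Φm := by
  have key : ∀ {Φ : Formula V} {W : Finset V}, vars Φ ⊆ W → Φ ⊆ Φs ∪ Φm →
      SolverInv I W (Φs ∪ Φm) Φ none Φ [] := by
    intro Φ W hW hΦ
    refine ⟨goodTrail_nil, subset_rfl, fun C hC x hx => hW ?_, fun C hC => .of_mem (hΦ hC),
      by simp, by simp [upTo]⟩
    simp only [vars, Finset.mem_biUnion, Finset.mem_image]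
    exact ⟨C, hC, x, hx, rfl⟩
  exact ⟨⟨key hs Finset.subset_union_left, key hm Finset.subset_union_right, rfl, by simp,
    by simp [level], .inl rfl⟩, .normal rfl rfl rfl⟩

theorem Reachable.inv {c : Config V} (h : Reachable Φs Φm I c) :
    c.Inv I (vars Φs ∪ I) (vars Φm ∪ I) (Φs ∪ Φm) Φs Φm := by
  induction h with
  | refl => exact initial_inv _ _ Finset.subset_union_left Finset.subset_union_left
  | tail _ h ih => exact h.inv Finset.subset_union_right Finset.subset_union_right ih

end ModeInv

/-! ### Progress -/

section Progress

variable {V : Type*} {I W W' Ws Wm : Finset V} {Φ₀ Φ Φ' Φs Φm : Formula V}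

/-- A false clause is asserting just below the highest level of its literals unless one of the
literals of that level has been implied. -/
theorem GoodTrail.exists_level {M : Trail V} (hg : GoodTrail I W Φ₀ M) {C : Clause V}
    (hC : Falsified M C) :
    ∃ t, Falsified (upTo t M) C ∧ (t = 0 ∨ ∃ k, t = k + 1 ∧ (AssertingAt M C k ∨
      ∃ x ∈ C, neg x ∉ lits (upTo k M) ∧ .decision (neg x) ∉ M)) := by
  classical
  -- The witness is the least level at which `C` is false, i.e. the highest level of its literals.
  have hex : ∃ t, Falsified (upTo t M) C := ⟨level M, by rwa [upTo_of_le le_rfl]⟩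
  refine ⟨Nat.find hex, Nat.find_spec hex, ?_⟩
  cases ht : Nat.find hex with
  | zero => exact .inl rfl
  | succ k =>
    refine .inr ⟨k, rfl, ?_⟩
    have hf : Falsified (upTo (k + 1) M) C := ht ▸ Nat.find_spec hex
    have hk : ¬ Falsified (upTo k M) C := Nat.find_min hex (by omega)
    by_contra! hcon
    obtain ⟨h1, h2⟩ := hcon
    -- If all literals of the top level are false by decisions of that level, they coincide, so that
    -- exactly one literal is unassigned one level below.
    have key : ∀ x ∈ C, neg x ∉ lits (upTo k M) →
        .decision (neg x) ∈ upTo (k + 1) M ∧ .decision (neg x) ∉ upTo k M := fun x hx hxk =>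
      ⟨hg.mem_of_suffix (upTo_suffix _ _) (h2 x hx hxk) rfl (hf x hx), fun h => hxk ⟨_, h, rfl⟩⟩
    simp only [Falsified, not_forall] at hk
    obtain ⟨x, hx, hxk⟩ := hk
    refine h1 ⟨x, hx, ⟨fun h => hg.neg_notMem (lits_upTo_subset _ _ h) (hC x hx), hxk⟩, ?_⟩
    intro y hy hyx
    by_contra hyk
    obtain ⟨a1, a2⟩ := key x hx hxk
    obtain ⟨b1, b2⟩ := key y hy hyk
    have := congrArg neg (decision_unique a1 b1 a2 b2)
    rw [lit_neg_neg, lit_neg_neg] at this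
    exact hyx this.symm

theorem AssertingAt.exists_isBackjumpLevel {M : Trail V} {C : Clause V} {k : ℕ}
    (h : AssertingAt M C k) : ∃ d ≤ k, IsBackjumpLevel M C d := by
  classical
  have hex : ∃ d, AssertingAt M C d := ⟨k, h⟩
  exact ⟨Nat.find hex, Nat.find_min' hex h, Nat.find_spec hex, fun _ hd => Nat.find_min' hex hd⟩

/-- The levels at which a clause is asserting form an interval: a literal that is false at a lower
level stays false, so the unit literal is the same at both ends. Hence one may jump to the maximum
of the back-jump level and a lower bound. -/
theorem AssertingAt.of_le_of_le {M : Trail V} {C : Clause V} {d e k : ℕ} (hd : AssertingAt M C d)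
    (hk : AssertingAt M C k) (hde : d ≤ e) (hek : e ≤ k) : AssertingAt M C e := by
  obtain ⟨l, h1, h2, h3⟩ := hd
  obtain ⟨l', h1', h2', h3'⟩ := hk
  have hl : l' = l := by
    by_contra hne
    exact h2'.2 (lits_upTo_mono (hde.trans hek) _ (h3 l' h1' hne))
  subst hl
  exact ⟨l', h1, ⟨fun h => h2'.1 (lits_upTo_mono hek _ h), fun h => h2'.2 (lits_upTo_mono hek _ h)⟩,
    fun x hx hxl => lits_upTo_mono hde _ (h3 x hx hxl)⟩

theorem fullSat_of_forall {M : Trail V} {D : Formula V} (hv : ∀ C ∈ D, ∀ x ∈ C, x.1 ∈ W)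
    (ha : ∀ v ∈ W, ∃ b, (v, b) ∈ lits M) (hf : ∀ C ∈ D, ¬ Falsified M C) : FullSat W M D := by
  refine ⟨ha, fun C hC => ?_⟩
  by_contra! hcon
  refine hf C hC fun x hx => ?_
  obtain ⟨b, hb⟩ := ha x.1 (hv C hC x hx)
  rcases eq_or_eq_neg (l := x) (r := (x.1, b)) rfl with h | h
  · exact absurd (h ▸ hb) (hcon x hx)
  · exact h ▸ hb

theorem exists_unassigned {M : Trail V} (h : ¬ ∀ v ∈ W, ∃ b, (v, b) ∈ lits M) :
    ∃ l : Lit V, l.1 ∈ W ∧ Unassigned M l := by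
  push Not at h
  obtain ⟨v, hv, hb⟩ := h
  exact ⟨(v, true), hv, hb _, hb _⟩

theorem GoodTrail.unassigned_upTo {M : Trail V} (hg : GoodTrail I W Φ₀ M) {k : ℕ} {x : Lit V}
    (hx : neg x ∈ lits M) (hk : neg x ∉ lits (upTo k M)) : Unassigned (upTo k M) (neg x) :=
  ⟨hk, fun h => hg.neg_notMem hx (lits_upTo_subset _ _ h)⟩

variable [DecidableEq V]

theorem exists_symStep_of_unit (α β : Mode) {D D' : Formula V} {M M' : Trail V} {C : Clause V}
    {l : Lit V} (hC : C ∈ D) (hu : UnitUnder M C l) :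
    ∃ a b, SymStep I ⟨α, none, D, M⟩ ⟨β, none, D', M'⟩ a b := by
  by_cases hl : l.1 ∈ I
  · by_cases hE : ∃ E ∈ D, Shared I E ∧ UnitUnder M' E l
    · obtain ⟨E, hE, hEI, hEu⟩ := hE
      exact ⟨_, _, .propS hC hu hl hE hEI hEu⟩
    · exact ⟨_, _, .propD hC hu hl hE⟩
  · exact ⟨_, _, .prop hC hu hl⟩

theorem noUnit_of_not_symStep {α β : Mode} {D D' : Formula V} {M M' : Trail V}
    (h : ∀ a b, ¬ SymStep I ⟨α, none, D, M⟩ ⟨β, none, D', M'⟩ a b) :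
    NoUnit M D ∧ ∀ C ∈ D, ¬ Falsified M C := by
  refine ⟨fun C hC l hu => ?_, fun C hC hf => h _ _ (.conflict hC hf)⟩
  obtain ⟨a, b, hab⟩ := exists_symStep_of_unit (I := I) (D' := D') (M' := M') α β hC hu
  exact h a b hab

/-- If neither resolution nor final analysis applies to a conflict clause, its literals are false by
decisions and by external literals whose final analysis fails. -/
theorem decision_or_ext_of_not_symStep {α β : Mode} {D D' : Formula V} {M M' : Trail V}
    {C : Clause V} (h : ∀ a b, ¬ SymStep I ⟨α, some C, D, M⟩ ⟨β, none, D', M'⟩ a b)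
    (hC : Falsified M C) {x : Lit V} (hx : x ∈ C) :
    .decision (neg x) ∈ M ∨ .ext (neg x) ∈ M ∧ ¬ ∃ c, AnalyzeFinal I M' (neg x) c := by
  obtain ⟨e, he, hel⟩ := hC x hx
  have hx' : neg (neg x) ∈ C := by simpa using hx
  cases e with
  | decision y => cases hel; exact .inl he
  | null => cases hel
  | prop y R => cases hel; exact absurd (.explain hx' he) (h _ _)
  | ext y =>
    cases hel
    exact .inr ⟨he, fun ⟨c, hc⟩ => h _ _ (.reason hx' he hc)⟩

/-- The literal is on the other trail too, where it can be neither a decision nor external; so it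
was propagated there, and its local causes can be resolved away. -/
theorem PairInv.exists_analyzeFinal {c c' : Option (Clause V)} {D D' : Formula V} {M M' : Trail V}
    (h : PairInv I W W' Φ₀ Φ Φ' c D M c' D' M') {k : ℕ} {l : Lit V} (hl : .ext l ∈ M)
    (hlk : l ∈ lits (SpecSMS.upTo k M)) (hd : decs (SpecSMS.upTo k M') = 0) :
    ∃ E, AnalyzeFinal I M' l E := by
  have hI := h.left.good.ext_mem hl
  obtain ⟨e, he, hel⟩ := (h.mem_lits_upTo hI k).1 hlk
  cases e with
  | decision y => exact absurd he (decision_notMem hd y)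
  | null => cases hel
  | prop y R => cases hel; exact h.right.good.exists_analyzeFinal hd he hI
  | ext y => cases hel; exact absurd ((upTo_suffix _ _).subset he) (h.ext _ hl)

/-- The secondary solver has no decisions. Its fully explained conflicts therefore consist of
external, hence shared, literals and can be passed on, and it can always answer Reason requests of
the main solver. -/
theorem progress_normal {cs cm : Option (Clause V)} {Ds Dm : Formula V} {Ms Mm : Trail V}
    (h : PairInv I Ws Wm Φ₀ Φs Φm cs Ds Ms cm Dm Mm) (hd : decs Ms = 0) :
    ∃ c, Step I Ws Wm (.run ⟨.P, cs, Ds, Ms⟩ ⟨.D 0, cm, Dm, Mm⟩) c := by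
  by_contra! hst
  have h1 := fun a b hab => hst _ (Step.sym_s (s' := a) (m' := b) hab)
  have h2 := fun a b hab => hst _ (Step.sym_m (s' := b) (m' := a) hab)
  cases cs with
  | some C =>
    obtain rfl : cm = none := h.conf.resolve_left (by simp)
    have hf := (h.left.conf C rfl).1
    have hsh : Shared I C := by
      intro x hx
      rcases decision_or_ext_of_not_symStep h1 hf hx with h3 | h3
      · exact absurd h3 (decision_notMem hd _)
      · exact h.left.good.ext_mem (l := neg x) h3.1
    by_cases hC : C ∈ Dm
    · exact hst _ (.explain_ms hsh hC)
    · exact hst _ (.learn_ms hsh hC)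
  | none =>
    cases cm with
    | none =>
      exact hst _ (.speculate (noUnit_of_not_symStep h1).1 (noUnit_of_not_symStep h2).1)
    | some C =>
      have hf := (h.right.conf C rfl).1
      by_cases hC : C ∈ Dm
      swap
      · exact hst _ (.learn_m trivial hC)
      obtain ⟨t, ht, rfl | ⟨k, rfl, ha | ⟨x, hx, -, hxd⟩⟩⟩ := h.right.good.exists_level hf
      · exact hst _ (.fail_m ht)
      · obtain ⟨d, -, hd⟩ := ha.exists_isBackjumpLevel
        exact hst _ (.backjump_m hC hd)
      -- The remaining literal would be external with a failing analysis, which cannot be as the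
      -- whole secondary trail is free of decisions.
      · obtain ⟨h3, h4⟩ := (decision_or_ext_of_not_symStep h2 hf hx).resolve_left hxd
        refine h4 (h.symm.exists_analyzeFinal (k := level Mm) h3 ?_ ?_)
        · rw [upTo_of_le le_rfl]; exact hf x hx
        · rw [upTo_of_le h.level_eq.le, hd]

/-- A conflict of the secondary solver after speculation has started can be dealt with, except
possibly if it depends on an external literal above the level of the speculation. -/
theorem progress_conf_left {i : ℕ} {μ : Mode} {C : Clause V} {Ds Dm : Formula V}
    {Ms Mm : Trail V} (h : PairInv I Ws Wm Φ₀ Φs Φm (some C) Ds Ms none Dm Mm)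
    (hd : Speculating i Ms Mm) (hμ : μ = .P ∨ μ = .F)
    (hst : ∀ c, ¬ Step I Ws Wm (.run ⟨.D i, some C, Ds, Ms⟩ ⟨μ, none, Dm, Mm⟩) c) :
    ∃ x ∈ C, .ext (neg x) ∈ Ms ∧ (¬ ∃ c, AnalyzeFinal I Mm (neg x) c) ∧
      neg x ∉ lits (upTo i Ms) := by
  have h1 := fun a b hab => hst _ (Step.sym_s (s' := a) (m' := b) hab)
  have hf := (h.left.conf C rfl).1
  have hC : C ∈ Ds := by
    by_contra hC
    exact hst _ (.learn_s hC)
  -- Up to level `i` the secondary trail has no decisions, so a conflict there is shared once it is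
  -- fully explained, and Exit applies. Otherwise the top level `k + 1` of the conflict lies above
  -- `i`.
  by_cases hfi : Falsified (upTo i Ms) C
  · have hsh : Shared I C := by
      intro x hx
      rcases decision_or_ext_of_not_symStep h1 hf hx with h3 | h3
      · exact absurd (h.left.good.mem_of_suffix (upTo_suffix _ _) h3 rfl (hfi x hx))
          (decision_notMem hd.decs_left _)
      · exact h.left.good.ext_mem (l := neg x) h3.1
    by_cases hC : C ∈ Dm
    · exact absurd (.exit_s hμ hsh hC hfi) (hst _)
    · exact absurd (.learn_ms hsh hC) (hst _)
  · obtain ⟨t, ht, rfl | ⟨k, rfl, h3⟩⟩ := h.left.good.exists_level hf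
    · exact absurd (ht.mono (lits_upTo_mono (Nat.zero_le i) _)) hfi
    · have hik : i ≤ k := by
        by_contra hik
        exact hfi (ht.mono (lits_upTo_mono (by omega) _))
      rcases h3 with ha | ⟨x, hx, hxk, hxd⟩
      · obtain ⟨d, hdk, hbd⟩ := ha.exists_isBackjumpLevel
        exact absurd (.backjump_s hμ hC hbd rfl
          (AssertingAt.of_le_of_le hbd.1 ha (le_max_left _ _) (max_le hdk hik))) (hst _)
      · obtain ⟨h4, h5⟩ := (decision_or_ext_of_not_symStep h1 hf hx).resolve_left hxd
        exact ⟨x, hx, h4, h5, fun h => hxk (lits_upTo_mono hik _ h)⟩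

/-- A secondary conflict on which conflict analysis is stuck yields a literal for Refine. A main
conflict is passed on if shared; if not, it contains the negation of a local main decision, and
either Exit or the third form of Refine applies. -/
theorem progress_speculate {i : ℕ} {cs cm : Option (Clause V)} {Ds Dm : Formula V}
    {Ms Mm : Trail V} (h : PairInv I Ws Wm Φ₀ Φs Φm cs Ds Ms cm Dm Mm)
    (hd : Speculating i Ms Mm) :
    ∃ c, Step I Ws Wm (.run ⟨.D i, cs, Ds, Ms⟩ ⟨.P, cm, Dm, Mm⟩) c := by
  by_contra! hst
  have h1 := fun a b hab => hst _ (Step.sym_s (s' := a) (m' := b) hab)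
  have h2 := fun a b hab => hst _ (Step.sym_m (s' := b) (m' := a) hab)
  cases cs with
  | some C =>
    obtain rfl : cm = none := h.conf.resolve_left (by simp)
    have hf := (h.left.conf C rfl).1
    obtain ⟨x, hx, h3, h4, h5⟩ := progress_conf_left h hd (.inl rfl) hst
    have hI := h.left.good.ext_mem h3
    refine hst _ (.refine_s (r := neg x) (by simpa using hx) h3 h4 ?_ rfl)
    refine h.right.good.unassigned_upTo ((h.mem_lits hI).1 (hf x hx)) ?_
    rwa [← h.mem_lits_upTo hI]
  | none =>
    cases cm with
    | none =>
      obtain ⟨h3, h4⟩ := noUnit_of_not_symStep h1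
      by_cases ha : ∀ v ∈ Ws, ∃ b, (v, b) ∈ lits Ms
      · exact hst _ (.fa_s_validate (fullSat_of_forall h.left.dbVars ha h4))
      · obtain ⟨l, hl, hu⟩ := exists_unassigned ha
        by_cases hI : l.1 ∈ I
        · exact hst _ (.decide_sS h3 (noUnit_of_not_symStep h2).1 hl hI hu)
        · exact hst _ (.decide_s (.inl rfl) h3 (noUnit_of_not_symStep h2).1 hl hI hu)
    | some C =>
      have hf := (h.right.conf C rfl).1
      by_cases hsh : Shared I C
      · by_cases hC : C ∈ Ds
        · exact hst _ (.explain_sm (.inl rfl) hsh hC)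
        · exact hst _ (.learn_sm hsh hC)
      · simp only [Shared, not_forall] at hsh
        obtain ⟨x, hx, hxI⟩ := hsh
        have hxd := (decision_or_ext_of_not_symStep h2 hf hx).resolve_right
          fun h3 => hxI (h.right.good.ext_mem (l := neg x) h3.1)
        by_cases hfi : Falsified (upTo i Mm) C
        · exact hst _ (.exit_m hfi)
        · simp only [Falsified, not_forall] at hfi
          obtain ⟨y, hy, hyi⟩ := hfi
          -- The literal of `y` lies above `i`, where the main solver has no decision; so it is
          -- external and shared.
          rcases decision_or_ext_of_not_symStep h2 hf hy with h3 | h3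
          · exact hyi ⟨_, decision_mem_of_decs_le (upTo_suffix _ _) hd.decs_right h3, rfl⟩
          · have hI := h.right.good.ext_mem h3.1
            exact hst _ (.refine_sm hx hxI hxd ((h.mem_lits hI).2 (hf y hy)) hI
              (h.right.good.unassigned_upTo (hf y hy) hyi) rfl)

/-- Refine is not needed here: the main solver has assigned all interface variables up to level `i`,
so no external literal lies above `i`, and only local decisions remain. -/
theorem progress_finish (hW' : I ⊆ Wm) {i : ℕ} {cs : Option (Clause V)} {Ds Dm Ψ : Formula V}
    {Ms Mm : Trail V} (h : PairInv I Ws Wm Φ₀ Φs Φm cs Ds Ms none Dm Mm)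
    (hd : Speculating i Ms Mm) (hfs : FullSat Wm (upTo i Mm) Ψ) :
    ∃ c, Step I Ws Wm (.run ⟨.D i, cs, Ds, Ms⟩ ⟨.F, none, Dm, Mm⟩) c := by
  by_contra! hst
  have h1 := fun a b hab => hst _ (Step.sym_s (s' := a) (m' := b) hab)
  have h2 := fun a b hab => hst _ (Step.sym_m (s' := b) (m' := a) hab)
  cases cs with
  | some C =>
    have hf := (h.left.conf C rfl).1
    obtain ⟨x, hx, h3, -, h5⟩ := progress_conf_left h hd (.inr rfl) hst
    have hI := h.left.good.ext_mem h3
    rw [h.mem_lits_upTo hI] at h5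
    exact h5 (h.mem_upTo_of_fullSat hW' hfs hI ((h.mem_lits hI).1 (hf x hx)))
  | none =>
    obtain ⟨h3, h4⟩ := noUnit_of_not_symStep h1
    by_cases ha : ∀ v ∈ Ws, ∃ b, (v, b) ∈ lits Ms
    · exact hst _ (.fa_s_final (fullSat_of_forall h.left.dbVars ha h4))
    · obtain ⟨l, hl, hu⟩ := exists_unassigned ha
      have hI : l.1 ∉ I := by
        intro hI
        obtain ⟨b, hb⟩ := hfs.1 l.1 (hW' hI)
        replace hb := (h.mem_lits (l := (l.1, b)) hI).2 (lits_upTo_subset _ _ hb)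
        rcases eq_or_eq_neg (l := l) (r := (l.1, b)) rfl with hr | hr
        · exact hu.1 (hr ▸ hb)
        · exact hu.2 (hr ▸ hb)
      exact hst _ (.decide_s (.inr rfl) h3 (noUnit_of_not_symStep h2).1 hl hI hu)

theorem progress_validate {i j : ℕ} {cm : Option (Clause V)} {Ds Dm : Formula V}
    {Ms Mm : Trail V} (h : PairInv I Ws Wm Φ₀ Φs Φm none Ds Ms cm Dm Mm)
    (hd : Validating i j Ms Mm) :
    ∃ c, Step I Ws Wm (.run ⟨.F, none, Ds, Ms⟩ ⟨.DV i j, cm, Dm, Mm⟩) c := by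
  by_contra! hst
  have h1 := fun a b hab => hst _ (Step.sym_s (s' := a) (m' := b) hab)
  have h2 := fun a b hab => hst _ (Step.sym_m (s' := b) (m' := a) hab)
  cases cm with
  | none =>
    obtain ⟨h3, h4⟩ := noUnit_of_not_symStep h2
    by_cases ha : ∀ v ∈ Wm, ∃ b, (v, b) ∈ lits Mm
    · exact hst _ (.fa_validated (fullSat_of_forall h.right.dbVars ha h4))
    · obtain ⟨l, hl, hu⟩ := exists_unassigned ha
      by_cases hI : l.1 ∈ I
      · exact hst _ (.decide_mS trivial (noUnit_of_not_symStep h1).1 h3 hl hI hu)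
      · exact hst _ (.decide_m trivial (noUnit_of_not_symStep h1).1 h3 hl hI hu)
  | some C =>
    have hf := (h.right.conf C rfl).1
    by_cases hC : C ∈ Dm
    swap
    · exact hst _ (.learn_m trivial hC)
    have href : ∀ x ∈ C, .ext (neg x) ∈ Mm → (¬ ∃ c, AnalyzeFinal I Ms (neg x) c) →
        neg x ∉ lits (upTo i Mm) → False := fun x hx h3 h4 h5 =>
      hst _ (.refine_m (r := neg x) (by simpa using hx) h3 h4
        (h.right.good.unassigned_upTo (hf x hx) h5) rfl)
    obtain ⟨t, ht, rfl | ⟨k, rfl, ha | ⟨x, hx, hxk, hxd⟩⟩⟩ := h.right.good.exists_level hf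
    · exact hst _ (.fail_m ht)
    · obtain ⟨d, hdk, hbd⟩ := ha.exists_isBackjumpLevel
      by_cases hdi : d < i
      · exact hst _ (.backjumpVE_m hC hbd hdi)
      by_cases hjk : j ≤ k
      · exact hst _ (.backjumpV_m hC hbd (by omega) rfl
          (AssertingAt.of_le_of_le hbd.1 ha (le_max_right _ _) (max_le hjk hdk)))
      -- Now `i ≤ d ≤ k < j`, and `C` is false rather than unit at level `j`, so no back-jump
      -- applies. The unit literal becomes false at level `k + 1`, above `i` and at most `j`, where
      -- the main solver has no decision; hence it is false by an external literal, to which Refine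
      -- applies.
      obtain ⟨x, hx, hxu, -⟩ := ha
      have hxi : neg x ∉ lits (upTo i Mm) :=
        fun h3 => hxu.2 (lits_upTo_mono (by omega) _ h3)
      rcases decision_or_ext_of_not_symStep h2 hf hx with h3 | h3
      · have h4 := h.right.good.mem_of_suffix (upTo_suffix j Mm) h3 rfl
          (lits_upTo_mono (by omega) _ (ht x hx))
        exact hxi ⟨_, decision_mem_of_decs_le (upTo_suffix_upTo hd.le _) hd.decs_right h4, rfl⟩
      · exact href x hx h3.1 h3.2 hxi
    · obtain ⟨h3, h4⟩ := (decision_or_ext_of_not_symStep h2 hf hx).resolve_left hxd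
      by_cases hki : k + 1 ≤ i
      · exact h4 (h.symm.exists_analyzeFinal h3 (lits_upTo_mono hki _ (ht x hx)) hd.decs_left)
      · exact href x hx h3 h4 fun h5 => hxk (lits_upTo_mono (by omega) _ h5)

theorem Config.Inv.isFinal_or_step {c : Config V} (hW' : I ⊆ Wm)
    (h : c.Inv I Ws Wm Φ₀ Φs Φm) : c.IsFinal ∨ ∃ c', Step I Ws Wm c c' := by
  cases c with
  | unsat => exact .inl trivial
  | run s m =>
    obtain ⟨α, cs, Ds, Ms⟩ := s
    obtain ⟨β, cm, Dm, Mm⟩ := m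
    obtain ⟨hp, ⟨h1, h2, hd⟩ | ⟨h1, h2, hd⟩ | ⟨h1, h2, hd, hf, hc, ht⟩ |
      ⟨h1, h2, hd, hf, hc⟩ | ⟨h1, h2, hf, hf'⟩⟩ := h
    · cases h1; cases h2
      exact .inr (progress_normal hp hd)
    · cases h1; cases h2
      exact .inr (progress_speculate hp hd)
    · cases h1; cases h2; cases hc
      exact .inr (progress_finish hW' hp hd hf)
    · cases h1; cases h2; cases hc
      exact .inr (progress_validate hp hd)
    · exact .inl ⟨h1, h2⟩

end Progress

/-! ### Termination -/

section Lexicographic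

/-- The number with digits `v 0`, …, `v (n - 1)` in base `B`. -/
def digits (B : ℕ) (v : ℕ → ℕ) : ℕ → ℕ
  | 0 => 0
  | n + 1 => digits B v n * B + v n

theorem digits_lt_pow {B : ℕ} {v : ℕ → ℕ} (hv : ∀ k, v k < B) (n : ℕ) : digits B v n < B ^ n := by
  induction n with
  | zero => simp [digits]
  | succ n ih =>
    rw [digits, pow_succ]
    calc digits B v n * B + v n < digits B v n * B + B := Nat.add_lt_add_left (hv n) _
      _ = (digits B v n + 1) * B := by ring
      _ ≤ B ^ n * B := Nat.mul_le_mul_right _ ih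

theorem digits_mono (B : ℕ) {v w : ℕ → ℕ} {n : ℕ} (h : ∀ k < n, v k ≤ w k) :
    digits B v n ≤ digits B w n := by
  induction n with
  | zero => rfl
  | succ n ih =>
    exact Nat.add_le_add (Nat.mul_le_mul_right _ (ih fun k hk => h k (hk.trans n.lt_succ_self)))
      (h n n.lt_succ_self)

/-- Digit `0` is the most significant one. Only the digits of the smaller number need to be below
the base. -/
theorem digits_lt_digits {B : ℕ} {v w : ℕ → ℕ} (hv : ∀ k, v k < B) {k n : ℕ} (hk : k < n)
    (hle : ∀ k' < k, v k' ≤ w k') (hlt : v k < w k) : digits B v n < digits B w n := by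
  induction n with
  | zero => omega
  | succ n ih =>
    rw [digits, digits]
    rcases (Nat.lt_succ_iff_lt_or_eq.1 hk) with hk | rfl
    · calc digits B v n * B + v n < digits B v n * B + B := Nat.add_lt_add_left (hv n) _
        _ = (digits B v n + 1) * B := by ring
        _ ≤ digits B w n * B := Nat.mul_le_mul_right _ (ih hk)
        _ ≤ _ := Nat.le_add_right _ _
    · exact Nat.add_lt_add_of_le_of_lt (Nat.mul_le_mul_right _ (digits_mono B hle)) hlt

theorem toLex_lt_of_le {α β : Type*} [PartialOrder α] [Preorder β] {a a' : α} {b b' : β}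
    (h : a < a' ∨ a ≤ a' ∧ b < b') : toLex (a, b) < toLex (a', b') := by
  rw [Prod.Lex.toLex_lt_toLex']
  rcases h with h | h
  · exact ⟨h.le, fun h' => absurd h' h.ne⟩
  · exact ⟨h.1, fun _ => h.2⟩

end Lexicographic

/-! ### The decreasing measure -/

section Energy

variable {V : Type*}

/-- A value for the levels up to `k` of the trails `M` and `M'` of the secondary and of the main
solver: decisions of the main solver count most, and `u` is credited at the highest level. -/
def height (K : ℕ) (M M' : Trail V) (u k : ℕ) : ℕ :=
  K * decs (upTo k M') + 2 * (numLits (upTo k M) + numLits (upTo k M')) +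
    if level M' ≤ k then u else 0

open Classical in
/-- One point each for a unit clause and for a conflict. -/
noncomputable def bonus (s m : Solver V) : ℕ :=
  (if NoUnit s.trail s.db ∧ NoUnit m.trail m.db then 0 else 1) +
    if s.conf = none ∧ m.conf = none then 0 else 1

/-- The trails `N`, `N'` with credit `w` are higher than the trails `M`, `M'` with credit `u`. -/
def HeightLT (K n : ℕ) (M M' : Trail V) (u : ℕ) (N N' : Trail V) (w : ℕ) : Prop :=
  ∃ k ≤ n, (∀ k' < k, height K M M' u k' ≤ height K N N' w k') ∧
    height K M M' u k < height K N N' w k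

theorem bonus_le_two (s m : Solver V) : bonus s m ≤ 2 := by
  unfold bonus
  split_ifs <;> omega

theorem NoUnit.mono {M : Trail V} {D D' : Formula V} (h : NoUnit M D') (hD : D ⊆ D') : NoUnit M D :=
  fun C hC => h C (hD hC)

/-- Under unchanged literals, additional clauses can create unit clauses but cannot remove any. -/
theorem bonus_mono {s m s' m' : Solver V} (hs : lits s'.trail = lits s.trail)
    (hm : lits m'.trail = lits m.trail) (hds : s.db ⊆ s'.db) (hdm : m.db ⊆ m'.db)
    (hc : s'.conf = none ∧ m'.conf = none → s.conf = none ∧ m.conf = none) :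
    bonus s m ≤ bonus s' m' := by
  have key : NoUnit s'.trail s'.db ∧ NoUnit m'.trail m'.db →
      NoUnit s.trail s.db ∧ NoUnit m.trail m.db := by
    rintro ⟨h1, h2⟩
    constructor
    · simpa [NoUnit, UnitUnder, Unassigned, hs] using h1.mono hds
    · simpa [NoUnit, UnitUnder, Unassigned, hm] using h2.mono hdm
  unfold bonus
  split_ifs <;> first | omega | tauto

theorem bonus_pos_of_unit {s m : Solver V}
    (h : ¬ (NoUnit s.trail s.db ∧ NoUnit m.trail m.db)) : 0 < bonus s m := by
  unfold bonus
  rw [if_neg h]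
  omega

theorem bonus_pos_of_conf {s m : Solver V} (h : ¬ (s.conf = none ∧ m.conf = none)) :
    0 < bonus s m := by
  unfold bonus
  rw [if_neg h]
  omega

theorem bonus_le_one {s m : Solver V} (h : s.conf = none ∧ m.conf = none) : bonus s m ≤ 1 := by
  unfold bonus
  rw [if_pos h]
  split_ifs <;> omega

theorem bonus_eq_zero {s m : Solver V} (h : s.conf = none ∧ m.conf = none)
    (h' : NoUnit s.trail s.db ∧ NoUnit m.trail m.db) : bonus s m = 0 := by
  unfold bonus
  rw [if_pos h, if_pos h']

theorem heightLT_of_bonus {K n : ℕ} {M M' : Trail V} {u w : ℕ} (hn : level M' ≤ n) (hu : u < w) :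
    HeightLT K n M M' u M M' w :=
  ⟨level M', hn, fun k' hk' => by simp [height, not_le.2 hk'], by simp [height, hu]⟩

/-- The comparison takes place at the new current level, where a new literal is worth two points and
outweighs the lost credit of at most one. If a level is opened, the credit must be zero, for it
would be lost at the old level with no literal gained there. -/
theorem heightLT_of_suffix {K n : ℕ} {M M' N N' : Trail V} {u w : ℕ} (hn : level N' ≤ n)
    (hM : ∀ k, upTo k M <:+ upTo k N) (hM' : ∀ k, upTo k M' <:+ upTo k N')
    (hl : level M ≤ level N') (hl' : level M' ≤ level N') (hN : level N = level N')
    (hc : numLits M + numLits M' < numLits N + numLits N') (hu : u ≤ 1)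
    (hu' : u = 0 ∨ level N' = level M') : HeightLT K n M M' u N N' w := by
  have key : ∀ k, K * decs (upTo k M') ≤ K * decs (upTo k N') := fun k =>
    Nat.mul_le_mul_left _ (decs_le_of_suffix (hM' k))
  refine ⟨level N', hn, fun k hk => ?_, ?_⟩
  · have h1 := key k
    have h2 := numLits_le_of_suffix (hM k)
    have h3 := numLits_le_of_suffix (hM' k)
    unfold height
    split_ifs <;> omega
  · have h1 := key (level N')
    have h2 := numLits_le_of_suffix (hM (level N'))
    unfold height
    rw [upTo_of_le (M := M) hl, upTo_of_le (M := M') hl', upTo_of_le (M := N) hN.le,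
      upTo_of_le (M := N') le_rfl] at *
    rw [if_pos hl', if_pos le_rfl]
    omega

/-- Up to `k` the trails are unchanged. Before the jump the credit sits above `k`; afterwards the
positive credit `w` is added at `k`. -/
theorem heightLT_of_upTo {K n : ℕ} {M M' : Trail V} {u w k : ℕ} (hn : level M' ≤ n)
    (hk : k < level M') (hw : 0 < w) : HeightLT K n M M' u (upTo k M) (upTo k M') w := by
  refine ⟨k, by omega, fun k' hk' => ?_, ?_⟩
  · unfold height
    rw [upTo_upTo, upTo_upTo, min_eq_left hk'.le, if_neg (by omega)]
    omega
  · unfold height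
    rw [upTo_upTo, upTo_upTo, min_self, if_neg (by omega), if_pos]
    · omega
    · rw [level_upTo]; omega

/-- Level `i + 1` was opened by the secondary solver alone, so it now holds one more main decision.
The bound on `K` makes this outweigh all discarded literals and a credit of two. -/
theorem heightLT_of_refine {K n : ℕ} {M M' : Trail V} {u w i : ℕ} (hn : level M' ≤ n)
    (hl : level M = level M') (hi : i < level M') (hu : u ≤ 2)
    (hK : 2 * (numLits M + numLits M') + 3 ≤ K)
    (hd : decs (upTo (i + 1) M') ≤ decs (upTo i M')) (r : Lit V) :
    HeightLT K n M M' u (.ext r :: .null :: upTo i M) (.decision r :: upTo i M') w := by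
  have hlM : level (upTo i M) = i := by rw [level_upTo]; omega
  have hlM' : level (upTo i M') = i := by rw [level_upTo]; omega
  have hlN : level (.ext r :: .null :: upTo i M) = i + 1 := by
    simp [level_cons, Entry.opensLevel, hlM]
  have hlN' : level (.decision r :: upTo i M') = i + 1 := by
    simp [level_cons, Entry.opensLevel, hlM']
  refine ⟨i + 1, hi.trans_le hn, fun k hk => ?_, ?_⟩
  · unfold height
    rw [upTo_ext_null (by omega), upTo_cons_of_lt (e := .decision r) (by omega), upTo_upTo,
      upTo_upTo, min_eq_left (by omega), if_neg (by omega)]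
    omega
  · have h1 := numLits_le_of_suffix (upTo_suffix (i + 1) M)
    have h2 := numLits_le_of_suffix (upTo_suffix (i + 1) M')
    have h3 := Nat.mul_le_mul_left K hd
    unfold height
    rw [upTo_of_le hlN.le, upTo_of_le hlN'.le, decs_decision, Nat.mul_succ]
    split_ifs <;> omega

/-- A number that orders the search modes and the location of the conflict. -/
def rank (s m : Solver V) : ℕ :=
  match s.mode, m.mode, s.conf, m.conf with
  | .P, _, none, none => 3
  | .D _, .P, none, none => 2
  | .D _, _, none, none => 1
  | .F, .DV _ _, none, none => 1
  | .D _, _, none, some _ => 3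
  | .D _, _, some _, _ => 2
  | .P, _, some _, _ => 1
  | _, _, _, _ => 0

/-- The weight of a decision of the main solver in `height`. -/
def scale (Ws Wm : Finset V) : ℕ := 2 * (Ws.card + Wm.card) + 3

/-- The amount by which the trails can still grow in the lexicographic order. -/
noncomputable def trailGap (Ws Wm : Finset V) (s m : Solver V) : ℕ :=
  (scale Ws Wm * (Wm.card + 1)) ^ (Ws.card + Wm.card + 1) -
    digits (scale Ws Wm * (Wm.card + 1)) (height (scale Ws Wm) s.trail m.trail (bonus s m))
      (Ws.card + Wm.card + 1)

/-- The number of clauses that can still be learned. -/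
def dbGap (Ws Wm : Finset V) (s m : Solver V) : ℕ :=
  2 ^ (Ws.card * 2) + 2 ^ (Wm.card * 2) - (s.db.card + m.db.card)

variable {I W W' Ws Wm : Finset V} {Φ₀ Φ Φ' Φs Φm : Formula V}

theorem SolverInv.card_db_le {c : Option (Clause V)} {D : Formula V} {M : Trail V}
    (h : SolverInv I W Φ₀ Φ c D M) : D.card ≤ 2 ^ (W.card * 2) := by
  have : D ⊆ (W ×ˢ (Finset.univ : Finset Bool)).powerset := by
    intro C hC
    rw [Finset.mem_powerset]
    intro x hx
    simpa using h.dbVars C hC x hx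
  simpa using Finset.card_le_card this

theorem trailGap_le {s m s' m' : Solver V}
    (hle : ∀ k, height (scale Ws Wm) s.trail m.trail (bonus s m) k ≤
      height (scale Ws Wm) s'.trail m'.trail (bonus s' m') k) :
    trailGap Ws Wm s' m' ≤ trailGap Ws Wm s m :=
  Nat.sub_le_sub_left (digits_mono _ fun k _ => hle k) _

theorem trailGap_le_of_trail_eq {s m s' m' : Solver V} (hs : s'.trail = s.trail)
    (hm : m'.trail = m.trail) (hds : s.db ⊆ s'.db) (hdm : m.db ⊆ m'.db)
    (hc : s'.conf = none ∧ m'.conf = none → s.conf = none ∧ m.conf = none) :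
    trailGap Ws Wm s' m' ≤ trailGap Ws Wm s m := by
  refine trailGap_le fun k => ?_
  have := bonus_mono (by rw [hs]) (by rw [hm]) hds hdm hc
  unfold height
  rw [hs, hm]
  split_ifs <;> omega

theorem dbGap_anti {s m s' m' : Solver V} (hds : s.db ⊆ s'.db) (hdm : m.db ⊆ m'.db) :
    dbGap Ws Wm s' m' ≤ dbGap Ws Wm s m :=
  Nat.sub_le_sub_left (Nat.add_le_add (Finset.card_le_card hds) (Finset.card_le_card hdm)) _

theorem rank_explain (α β : Mode) (C C' : Clause V) (D D' E E' : Formula V)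
    (M M' N N' : Trail V) :
    rank ⟨α, some C, D, M⟩ ⟨β, none, E, N⟩ = rank ⟨α, some C', D', M'⟩ ⟨β, none, E', N'⟩ ∧
      rank ⟨β, none, E, N⟩ ⟨α, some C, D, M⟩ = rank ⟨β, none, E', N'⟩ ⟨α, some C', D', M'⟩ := by
  cases α <;> cases β <;> exact ⟨rfl, rfl⟩

theorem AssertingAt.lt_level {M : Trail V} {C : Clause V} {k : ℕ} (h : AssertingAt M C k)
    (hf : Falsified M C) : k < level M := by
  obtain ⟨l, hl⟩ := h
  by_contra hk
  rw [upTo_of_le (by omega)] at hl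
  exact hf.not_unitUnder subset_rfl l hl

theorem Speculating.decs_succ_le {i : ℕ} {M M' : Trail V} (h : Speculating i M M') :
    decs (SpecSMS.upTo (i + 1) M') ≤ decs (SpecSMS.upTo i M') :=
  (decs_le_of_suffix (upTo_suffix _ _)).trans h.decs_right

variable [DecidableEq V]

/-- The weight of the conflict clause of a solver. -/
def Solver.weight (a : Solver V) : ℕ := a.conf.elim 0 fun C => SpecSMS.weight C a.trail

/-- A measure that decreases in every step. -/
noncomputable def energy (Ws Wm : Finset V) : Config V → ℕ ×ₗ ℕ ×ₗ ℕ ×ₗ ℕ ×ₗ ℕ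
  | .run s m => toLex (trailGap Ws Wm s m, toLex (rank s m, toLex (dbGap Ws Wm s m,
      toLex (numExt s.trail + numExt m.trail, s.weight + m.weight))))
  | .unsat => toLex (0, toLex (0, toLex (0, toLex (0, 0))))

/-- Every level is opened by a decision of one of the solvers, and the decisions of a solver concern
distinct variables. -/
theorem PairInv.level_le_card {c c' : Option (Clause V)} {D D' : Formula V} {M M' : Trail V}
    (h : PairInv I W W' Φ₀ Φ Φ' c D M c' D' M') : level M' ≤ W.card + W'.card := by
  have h1 := h.level_le (level M)
  have h2 := h.level_eq
  rw [upTo_of_le le_rfl, upTo_of_le h2.ge] at h1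
  have h3 := (decs_le_numLits M).trans h.left.good.numLits_le
  have h4 := (decs_le_numLits M').trans h.right.good.numLits_le
  omega

theorem PairInv.height_lt {c c' : Option (Clause V)} {D D' : Formula V} {M M' : Trail V}
    (h : PairInv I W W' Φ₀ Φ Φ' c D M c' D' M') {u : ℕ} (hu : u ≤ 2) (k : ℕ) :
    height (scale W W') M M' u k < scale W W' * (W'.card + 1) := by
  have h1 := (h.left.upTo k).good.numLits_le
  have h2 := (h.right.upTo k).good.numLits_le
  have h3 := Nat.mul_le_mul_left (scale W W') ((decs_le_numLits _).trans h2)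
  have h4 : scale W W' = 2 * (W.card + W'.card) + 3 := rfl
  rw [mul_add, mul_one]
  unfold height
  split_ifs <;> omega

theorem trailGap_lt {s m s' m' : Solver V}
    (h : PairInv I Ws Wm Φ₀ Φs Φm s.conf s.db s.trail m.conf m.db m.trail)
    (hlt : HeightLT (scale Ws Wm) (Ws.card + Wm.card) s.trail m.trail (bonus s m)
      s'.trail m'.trail (bonus s' m')) : trailGap Ws Wm s' m' < trailGap Ws Wm s m := by
  obtain ⟨k, hk, h1, h2⟩ := hlt
  have hb := h.height_lt (bonus_le_two s m)
  have h3 := digits_lt_digits hb (Nat.lt_add_one_of_le hk) h1 h2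
  have h4 := digits_lt_pow hb (Ws.card + Wm.card + 1)
  -- The old number is below the power, so even truncated subtraction decreases strictly; the new
  -- trails need no bound.
  unfold trailGap
  omega

theorem energy_lt_of_heightLT {s m s' m' : Solver V}
    (h : PairInv I Ws Wm Φ₀ Φs Φm s.conf s.db s.trail m.conf m.db m.trail)
    (hlt : HeightLT (scale Ws Wm) (Ws.card + Wm.card) s.trail m.trail (bonus s m)
      s'.trail m'.trail (bonus s' m')) :
    energy Ws Wm (.run s' m') < energy Ws Wm (.run s m) :=
  toLex_lt_of_le (.inl (trailGap_lt h hlt))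

theorem energy_lt_of_rank {s m s' m' : Solver V} (hs : s'.trail = s.trail)
    (hm : m'.trail = m.trail) (hds : s.db ⊆ s'.db) (hdm : m.db ⊆ m'.db)
    (hc : s'.conf = none ∧ m'.conf = none → s.conf = none ∧ m.conf = none)
    (hr : rank s' m' < rank s m) : energy Ws Wm (.run s' m') < energy Ws Wm (.run s m) :=
  toLex_lt_of_le (.inr ⟨trailGap_le_of_trail_eq hs hm hds hdm hc, toLex_lt_of_le (.inl hr)⟩)

/-- The bound on the new databases, which contain only clauses over the solvers' variables, keeps
the truncated difference from stagnating at zero. -/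
theorem energy_lt_of_learn {s m s' m' : Solver V} (hs : s'.trail = s.trail)
    (hm : m'.trail = m.trail) (hds : s.db ⊆ s'.db) (hdm : m.db ⊆ m'.db)
    (hc : s'.conf = none ∧ m'.conf = none → s.conf = none ∧ m.conf = none)
    (hr : rank s' m' ≤ rank s m)
    (hd : s.db.card + m.db.card < s'.db.card + m'.db.card)
    (h' : PairInv I Ws Wm Φ₀ Φs Φm s'.conf s'.db s'.trail m'.conf m'.db m'.trail) :
    energy Ws Wm (.run s' m') < energy Ws Wm (.run s m) := by
  refine toLex_lt_of_le (.inr ⟨trailGap_le_of_trail_eq hs hm hds hdm hc,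
    toLex_lt_of_le (.inr ⟨hr, toLex_lt_of_le (.inl ?_)⟩)⟩)
  have h1 := h'.left.card_db_le
  have h2 := h'.right.card_db_le
  unfold dbGap
  omega

theorem energy_lt_of_explain {s m s' m' : Solver V} (hs : s'.trail = s.trail)
    (hm : m'.trail = m.trail) (hds : s'.db = s.db) (hdm : m'.db = m.db)
    (hc : s'.conf = none ∧ m'.conf = none → s.conf = none ∧ m.conf = none)
    (hr : rank s' m' ≤ rank s m) (hw : s'.weight + m'.weight < s.weight + m.weight) :
    energy Ws Wm (.run s' m') < energy Ws Wm (.run s m) := by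
  refine toLex_lt_of_le (.inr ⟨trailGap_le_of_trail_eq hs hm hds.ge hdm.ge hc,
    toLex_lt_of_le (.inr ⟨hr, toLex_lt_of_le (.inr ⟨?_, toLex_lt_of_le (.inr ⟨?_, hw⟩)⟩)⟩)⟩)
  · rw [dbGap, dbGap, hds, hdm]
  · rw [hs, hm]

theorem energy_lt_of_reason {s m s' m' : Solver V}
    (hs : ∀ k, numLits (upTo k s'.trail) = numLits (upTo k s.trail))
    (hsl : lits s'.trail = lits s.trail)
    (hm : ∀ k, numLits (upTo k m'.trail) = numLits (upTo k m.trail))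
    (hmd : ∀ k, decs (upTo k m'.trail) = decs (upTo k m.trail))
    (hl : level m'.trail = level m.trail) (hml : lits m'.trail = lits m.trail)
    (hds : s.db ⊆ s'.db) (hdm : m.db ⊆ m'.db)
    (hc : s'.conf = none ∧ m'.conf = none → s.conf = none ∧ m.conf = none)
    (hr : rank s' m' ≤ rank s m)
    (hx : numExt s'.trail + numExt m'.trail < numExt s.trail + numExt m.trail) :
    energy Ws Wm (.run s' m') < energy Ws Wm (.run s m) := by
  refine toLex_lt_of_le (.inr ⟨trailGap_le fun k => ?_, toLex_lt_of_le (.inr ⟨hr,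
    toLex_lt_of_le (.inr ⟨dbGap_anti hds hdm, toLex_lt_of_le (.inl hx)⟩)⟩)⟩)
  have := bonus_mono hsl hml hds hdm hc
  unfold height
  rw [hs, hm, hmd, hl]
  split_ifs <;> omega

/-- Adding a literal to the trails without opening a level increases their height. -/
theorem energy_lt_of_cons {s m s' m' : Solver V}
    (h : PairInv I Ws Wm Φ₀ Φs Φm s.conf s.db s.trail m.conf m.db m.trail)
    (h' : PairInv I Ws Wm Φ₀ Φs Φm s'.conf s'.db s'.trail m'.conf m'.db m'.trail)
    (hc : s.conf = none ∧ m.conf = none)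
    (hs : ∀ k, upTo k s.trail <:+ upTo k s'.trail) (hm : ∀ k, upTo k m.trail <:+ upTo k m'.trail)
    (hl : level m'.trail = level m.trail ∨
      level m.trail ≤ level m'.trail ∧ NoUnit s.trail s.db ∧ NoUnit m.trail m.db)
    (hn : numLits s.trail + numLits m.trail < numLits s'.trail + numLits m'.trail) :
    energy Ws Wm (.run s' m') < energy Ws Wm (.run s m) := by
  have h1 := h.level_eq
  have h2 := h'.level_eq
  refine energy_lt_of_heightLT h (heightLT_of_suffix h'.level_le_card hs hm ?_ ?_ h2 hn
    (bonus_le_one hc) ?_)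
  · rcases hl with hl | hl <;> omega
  · rcases hl with hl | hl <;> omega
  -- A step that may open a level is taken without unit clauses and conflicts, hence with zero
  -- credit.
  · exact hl.symm.imp (fun hl => bonus_eq_zero hc hl.2) id

theorem SymStep.energy_lt_left {s m s' m' : Solver V} (h : SymStep I s m s' m')
    (hp : PairInv I Ws Wm Φ₀ Φs Φm s.conf s.db s.trail m.conf m.db m.trail)
    (hp' : PairInv I Ws Wm Φ₀ Φs Φm s'.conf s'.db s'.trail m'.conf m'.db m'.trail) :
    energy Ws Wm (.run s' m') < energy Ws Wm (.run s m) := by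
  cases h with
  | prop hC hu hl =>
    exact energy_lt_of_cons hp hp' ⟨rfl, rfl⟩ (fun k => upTo_suffix_cons k _ _)
      (fun k => List.suffix_rfl) (.inl rfl) (by simp [numLits_cons, Entry.lit?])
  | propS hC hu hl hE hEI hEu =>
    exact energy_lt_of_cons hp hp' ⟨rfl, rfl⟩ (fun k => upTo_suffix_cons k _ _)
      (fun k => upTo_suffix_cons k _ _) (.inl (by simp [level_cons, Entry.opensLevel]))
      (by simp [numLits_cons, Entry.lit?]; omega)
  | propD hC hu hl hE =>
    exact energy_lt_of_cons hp hp' ⟨rfl, rfl⟩ (fun k => upTo_suffix_cons k _ _)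
      (fun k => upTo_suffix_cons k _ _) (.inl (by simp [level_cons, Entry.opensLevel]))
      (by simp [numLits_cons, Entry.lit?]; omega)
  | conflict hC hf =>
    refine energy_lt_of_heightLT hp (heightLT_of_bonus hp.level_le_card ?_)
    simp [bonus]
  | explain hC hR =>
    refine energy_lt_of_explain rfl rfl rfl rfl (by simp) (rank_explain ..).1.le ?_
    simpa [Solver.weight] using hp.left.good.weight_resolvent_lt hR hC
  | reason hC hl hc =>
    exact energy_lt_of_reason (fun k => by simp [upTo_setReason]) (lits_setReason _ _ _)
      (fun _ => rfl) (fun _ => rfl) rfl rfl (Finset.subset_insert _ _) subset_rfl (by simp)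
      (rank_explain ..).1.le (by simpa using numExt_setReason_lt _ hl)

theorem SymStep.energy_lt_right {s m s' m' : Solver V} (h : SymStep I m s m' s')
    (hp : PairInv I Ws Wm Φ₀ Φs Φm s.conf s.db s.trail m.conf m.db m.trail)
    (hp' : PairInv I Ws Wm Φ₀ Φs Φm s'.conf s'.db s'.trail m'.conf m'.db m'.trail) :
    energy Ws Wm (.run s' m') < energy Ws Wm (.run s m) := by
  cases h with
  | prop hC hu hl =>
    exact energy_lt_of_cons hp hp' ⟨rfl, rfl⟩ (fun k => List.suffix_rfl)
      (fun k => upTo_suffix_cons k _ _) (.inl rfl) (by simp [numLits_cons, Entry.lit?])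
  | propS hC hu hl hE hEI hEu =>
    exact energy_lt_of_cons hp hp' ⟨rfl, rfl⟩ (fun k => upTo_suffix_cons k _ _)
      (fun k => upTo_suffix_cons k _ _) (.inl (by simp [level_cons, Entry.opensLevel]))
      (by simp [numLits_cons, Entry.lit?]; omega)
  | propD hC hu hl hE =>
    exact energy_lt_of_cons hp hp' ⟨rfl, rfl⟩ (fun k => upTo_suffix_cons k _ _)
      (fun k => upTo_suffix_cons k _ _) (.inl (by simp [level_cons, Entry.opensLevel]))
      (by simp [numLits_cons, Entry.lit?]; omega)
  | conflict hC hf =>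
    refine energy_lt_of_heightLT hp (heightLT_of_bonus hp.level_le_card ?_)
    simp [bonus]
  | explain hC hR =>
    refine energy_lt_of_explain rfl rfl rfl rfl (by simp) (rank_explain ..).2.le ?_
    simpa [Solver.weight] using hp.right.good.weight_resolvent_lt hR hC
  | reason hC hl hc =>
    exact energy_lt_of_reason (fun _ => rfl) rfl (fun k => by simp [upTo_setReason])
      (fun k => by simp [upTo_setReason]) (level_setReason _ _ _) (lits_setReason _ _ _)
      subset_rfl (Finset.subset_insert _ _) (by simp)
      (rank_explain ..).2.le (by simpa using numExt_setReason_lt _ hl)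

theorem energy_lt_of_backjump {s m s' m' : Solver V} {k : ℕ}
    (h : PairInv I Ws Wm Φ₀ Φs Φm s.conf s.db s.trail m.conf m.db m.trail)
    (hs : s'.trail = upTo k s.trail) (hm : m'.trail = upTo k m.trail) (hk : k < level m.trail)
    (hb : 0 < bonus s' m') : energy Ws Wm (.run s' m') < energy Ws Wm (.run s m) := by
  refine energy_lt_of_heightLT h ?_
  rw [hs, hm]
  exact heightLT_of_upTo h.level_le_card hk hb

theorem energy_lt_of_backjump_left {s m s' m' : Solver V} {k : ℕ} {C : Clause V}
    (h : PairInv I Ws Wm Φ₀ Φs Φm s.conf s.db s.trail m.conf m.db m.trail)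
    (hs : s'.trail = upTo k s.trail) (hm : m'.trail = upTo k m.trail) (hc : s.conf = some C)
    (hC : C ∈ s'.db) (ha : AssertingAt s.trail C k) :
    energy Ws Wm (.run s' m') < energy Ws Wm (.run s m) := by
  have hk := ha.lt_level (h.left.conf C hc).1
  -- The credit at the target level comes from `C` itself, which lies in the database and has become
  -- unit.
  refine energy_lt_of_backjump h hs hm (hk.trans_eq h.level_eq) (bonus_pos_of_unit fun hn => ?_)
  obtain ⟨l, hl⟩ := ha
  exact hn.1 C hC l (hs ▸ hl)

theorem energy_lt_of_backjump_right {s m s' m' : Solver V} {k : ℕ} {C : Clause V}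
    (h : PairInv I Ws Wm Φ₀ Φs Φm s.conf s.db s.trail m.conf m.db m.trail)
    (hs : s'.trail = upTo k s.trail) (hm : m'.trail = upTo k m.trail) (hc : m.conf = some C)
    (hC : C ∈ m'.db) (ha : AssertingAt m.trail C k) :
    energy Ws Wm (.run s' m') < energy Ws Wm (.run s m) := by
  have hk := ha.lt_level (h.right.conf C hc).1
  refine energy_lt_of_backjump h hs hm hk (bonus_pos_of_unit fun hn => ?_)
  obtain ⟨l, hl⟩ := ha
  exact hn.2 C hC l (hm ▸ hl)

/-- Leaving speculation with a conflict. -/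
theorem energy_lt_of_exit {s m s' m' : Solver V} {i : ℕ}
    (h : PairInv I Ws Wm Φ₀ Φs Φm s.conf s.db s.trail m.conf m.db m.trail)
    (hs : s'.trail = upTo i s.trail) (hm : m'.trail = upTo i m.trail)
    (hds : s.db ⊆ s'.db) (hdm : m.db ⊆ m'.db)
    (hc : ¬ (s'.conf = none ∧ m'.conf = none)) (hr : rank s' m' < rank s m) :
    energy Ws Wm (.run s' m') < energy Ws Wm (.run s m) := by
  -- If levels are removed, the surviving conflict supplies credit at level `i`; otherwise the
  -- trails are unchanged and the rank decides.
  by_cases hi : i < level m.trail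
  · exact energy_lt_of_backjump h hs hm hi (bonus_pos_of_conf hc)
  · rw [upTo_of_le (by have := h.level_eq; omega)] at hs
    rw [upTo_of_le (by omega)] at hm
    exact energy_lt_of_rank hs hm hds hdm (fun h => absurd h hc) hr

theorem energy_lt_of_refine {s m s' m' : Solver V} {i : ℕ} {l r : Lit V}
    (h : PairInv I Ws Wm Φ₀ Φs Φm s.conf s.db s.trail m.conf m.db m.trail)
    (hs : s'.trail = .ext r :: .null :: upTo i s.trail)
    (hm : m'.trail = .decision r :: upTo i m.trail) (hl : l ∈ lits m.trail)
    (hu : Unassigned (upTo i m.trail) l)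
    (hd : decs (upTo (i + 1) m.trail) ≤ decs (upTo i m.trail)) :
    energy Ws Wm (.run s' m') < energy Ws Wm (.run s m) := by
  have hi : i < level m.trail := by
    by_contra hi
    rw [upTo_of_le (by omega)] at hu
    exact hu.1 hl
  have h1 := h.left.good.numLits_le
  have h2 := h.right.good.numLits_le
  refine energy_lt_of_heightLT h ?_
  rw [hs, hm]
  exact heightLT_of_refine h.level_le_card h.level_eq hi (bonus_le_two _ _)
    (by unfold scale; omega) hd r

theorem energy_unsat_lt {s m : Solver V}
    (h : PairInv I Ws Wm Φ₀ Φs Φm s.conf s.db s.trail m.conf m.db m.trail) :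
    energy Ws Wm .unsat < energy Ws Wm (.run s m) := by
  refine toLex_lt_of_le (.inl ?_)
  exact Nat.sub_pos_of_lt (digits_lt_pow (h.height_lt (bonus_le_two s m)) _)

theorem Step.energy_lt {c c' : Config V} (hW : I ⊆ Ws) (hW' : I ⊆ Wm)
    (h : Step I Ws Wm c c') (hc : c.Inv I Ws Wm Φ₀ Φs Φm) :
    energy Ws Wm c' < energy Ws Wm c := by
  have hc' := h.inv hW hW' hc
  cases h with
  | sym_s h => exact h.energy_lt_left hc.pair hc'.pair
  | sym_m h => exact h.energy_lt_right hc.pair hc'.pair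
  | decide_m hμ hs hm hl hI hu =>
    exact energy_lt_of_cons hc.pair hc'.pair ⟨rfl, rfl⟩ (fun k => upTo_suffix_cons k _ _)
      (fun k => upTo_suffix_cons k _ _) (.inr ⟨level_le_level_cons _ _, hs, hm⟩)
      (by simp [numLits_cons, Entry.lit?])
  | decide_mS hμ hs hm hl hI hu =>
    exact energy_lt_of_cons hc.pair hc'.pair ⟨rfl, rfl⟩
      (fun k => (upTo_suffix_cons k _ _).trans (upTo_suffix_cons k _ _))
      (fun k => upTo_suffix_cons k _ _) (.inr ⟨level_le_level_cons _ _, hs, hm⟩)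
      (by simp [numLits_cons, Entry.lit?]; omega)
  | decide_s hμ hs hm hl hI hu =>
    exact energy_lt_of_cons hc.pair hc'.pair ⟨rfl, rfl⟩ (fun k => upTo_suffix_cons k _ _)
      (fun k => upTo_suffix_cons k _ _) (.inr ⟨level_le_level_cons _ _, hs, hm⟩)
      (by simp [numLits_cons, Entry.lit?])
  | decide_sS hs hm hl hI hu =>
    exact energy_lt_of_cons hc.pair hc'.pair ⟨rfl, rfl⟩ (fun k => upTo_suffix_cons k _ _)
      (fun k => (upTo_suffix_cons k _ _).trans (upTo_suffix_cons k _ _))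
      (.inr ⟨(level_le_level_cons _ _).trans (level_le_level_cons _ _), hs, hm⟩)
      (by simp [numLits_cons, Entry.lit?]; omega)
  | speculate hs hm =>
    exact energy_lt_of_rank rfl rfl subset_rfl subset_rfl id (by simp [rank])
  | fa_m hf => exact energy_lt_of_rank rfl rfl subset_rfl subset_rfl id (by simp [rank])
  | fa_s_validate hf => exact energy_lt_of_rank rfl rfl subset_rfl subset_rfl id (by simp [rank])
  | fa_s_final hf => exact energy_lt_of_rank rfl rfl subset_rfl subset_rfl id (by simp [rank])
  | fa_validated hf => exact energy_lt_of_rank rfl rfl subset_rfl subset_rfl id (by simp [rank])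
  | learn_m hμ hC =>
    exact energy_lt_of_learn rfl rfl subset_rfl (Finset.subset_insert _ _) id le_rfl
      (by simp [Finset.card_insert_of_notMem hC]) hc'.pair
  | learn_s hC =>
    exact energy_lt_of_learn rfl rfl (Finset.subset_insert _ _) subset_rfl id le_rfl
      (by simp [Finset.card_insert_of_notMem hC]) hc'.pair
  | learn_ms hI hC =>
    exact energy_lt_of_learn rfl rfl subset_rfl (Finset.subset_insert _ _) id le_rfl
      (by simp [Finset.card_insert_of_notMem hC]) hc'.pair
  | learn_sm hI hC =>
    exact energy_lt_of_learn rfl rfl (Finset.subset_insert _ _) subset_rfl id le_rfl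
      (by simp [Finset.card_insert_of_notMem hC]) hc'.pair
  | explain_ms hI hC =>
    exact energy_lt_of_rank rfl rfl subset_rfl subset_rfl (by simp) (by simp [rank])
  | explain_sm hμ hI hC =>
    exact energy_lt_of_rank rfl rfl subset_rfl subset_rfl (by simp) (by simp [rank])
  | backjump_m hC hk => exact energy_lt_of_backjump_right hc.pair rfl rfl rfl hC hk.1
  | backtrack_m hC hk ha => exact energy_lt_of_backjump_right hc.pair rfl rfl rfl hC ha
  | backjump_s hμ hC hd hk ha => exact energy_lt_of_backjump_left hc.pair rfl rfl rfl hC ha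
  | backtrack_s hμ hC hk hi ha => exact energy_lt_of_backjump_left hc.pair rfl rfl rfl hC ha
  | backjumpV_m hC hd hi hk ha => exact energy_lt_of_backjump_right hc.pair rfl rfl rfl hC ha
  | backtrackV_m hC hk hj ha => exact energy_lt_of_backjump_right hc.pair rfl rfl rfl hC ha
  | backjumpVE_m hC hk hi => exact energy_lt_of_backjump_right hc.pair rfl rfl rfl hC hk.1
  | exit_s hμ hI hC hf =>
    exact energy_lt_of_exit hc.pair rfl rfl subset_rfl subset_rfl (by simp) (by simp [rank])
  | exit_m hf =>
    exact energy_lt_of_exit hc.pair rfl rfl subset_rfl subset_rfl (by simp) (by simp [rank])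
  | refine_s hC hl hfail hu hr =>
    obtain ⟨hp, hm⟩ := hc
    have hI := hp.left.good.ext_mem hl
    exact energy_lt_of_refine hp rfl rfl ((hp.mem_lits hI).1 ⟨_, hl, rfl⟩) hu
      (hm.of_D rfl).1.decs_succ_le
  | refine_sm hx hxI hxd hl hI hu hr =>
    obtain ⟨hp, hm⟩ := hc
    exact energy_lt_of_refine hp rfl rfl ((hp.mem_lits hI).1 hl) hu
      (hm.of_D rfl).1.decs_succ_le
  | @refine_m i j _ _ _ _ _ _ _ hC hl hfail hu hr =>
    obtain ⟨hp, hm⟩ := hc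
    obtain ⟨-, hd, hf, -⟩ := hm.of_DV rfl
    have hI := hp.right.good.ext_mem hl
    have hlM := lits_subset_of_suffix List.suffix_rfl ⟨_, hl, rfl⟩
    refine energy_lt_of_refine hp rfl rfl hlM hu ?_
    -- If `i = j`, the secondary solver would have assigned all its variables, in particular that of
    -- `l`, up to level `i`, where `l` is unassigned. So level `i + 1` is at most `j` and holds no
    -- main decision.
    have hij : i ≠ j := by
      rintro rfl
      have := hp.symm.mem_upTo_of_fullSat hW hf hI ((hp.mem_lits hI).2 hlM)
      exact hu.1 ((hp.mem_lits_upTo hI _).1 this)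
    exact (decs_le_of_suffix (upTo_suffix_upTo (lt_of_le_of_ne hd.le hij) _)).trans hd.decs_right
  | fail_s hf =>
    exact energy_lt_of_exit hc.pair rfl rfl subset_rfl (Finset.subset_insert _ _) (by simp)
      (by simp [rank])
  | fail_m hf => exact energy_unsat_lt hc.pair

end Energy

/-! ### Correctness of the final states, and the theorem -/

section Main

variable {V : Type*} [DecidableEq V] {I : Finset V} {Φs Φm : Formula V}

/-- In state `⟨F, F⟩` the join of the trails is a satisfying assignment. -/
theorem RunInv.isSatisfyingAssignment (hI : vars Φs ∩ vars Φm ⊆ I) {s m : Solver V}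
    (h : RunInv I (vars Φs ∪ I) (vars Φm ∪ I) (Φs ∪ Φm) Φs Φm s m) (hs : s.mode = .F)
    (hm : m.mode = .F) : IsSatisfyingAssignment (lits s.trail ∪ lits m.trail) (Φs ∪ Φm) := by
  obtain ⟨hp, ⟨h1, h2, hd⟩ | ⟨h1, h2, hd⟩ | ⟨h1, h2, hd, hf, hc, ht⟩ |
    ⟨h1, h2, hd, hf, hc⟩ | ⟨h1, h2, hf, hf'⟩⟩ := h
  · rw [hs] at h1; cases h1
  · rw [hs] at h1; cases h1
  · rw [hs] at h1; cases h1
  · rw [hm] at h2; cases h2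
  -- Variables on both trails belong to `I`, because those common to both formulas do; on `I` the
  -- trails agree.
  have hshared : ∀ l : Lit V, l ∈ lits s.trail → neg l ∉ lits m.trail := by
    intro l hl hn
    have hlI : l.1 ∈ I := by
      have v1 := hp.left.good.mem_vars hl
      have v2 := hp.right.good.mem_vars hn
      rw [neg_fst] at v2
      by_cases hlI : l.1 ∈ I
      · exact hlI
      · exact hI (Finset.mem_inter.2 ⟨(Finset.mem_union.1 v1).resolve_right hlI,
          (Finset.mem_union.1 v2).resolve_right hlI⟩)
    exact hp.right.good.neg_notMem ((hp.mem_lits hlI).1 hl) hn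
  refine ⟨?_, ?_, ?_⟩
  · rintro l (hl | hl) (hn | hn)
    · exact hp.left.good.neg_notMem hl hn
    · exact hshared l hl hn
    · exact hshared _ hn (by simpa using hl)
    · exact hp.right.good.neg_notMem hl hn
  · intro v hv
    rw [vars, Finset.union_biUnion, Finset.mem_union] at hv
    rcases hv with hv | hv
    · exact (hf.1 v (Finset.mem_union_left _ hv)).imp fun _ => .inl
    · exact (hf'.1 v (Finset.mem_union_left _ hv)).imp fun _ => .inr
  · intro C hC
    rcases Finset.mem_union.1 hC with hC | hC
    · exact (hf.2 C hC).imp fun _ hx => ⟨hx.1, .inl hx.2⟩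
    · exact (hf'.2 C hC).imp fun _ hx => ⟨hx.1, .inr hx.2⟩

/-- Variables without a literal in `L` receive the value `false`; consistency of `L` makes its
negative literals come out true. -/
theorem IsSatisfyingAssignment.satisfiable {L : Set (Lit V)} {Φ : Formula V}
    (h : IsSatisfyingAssignment L Φ) : Satisfiable Φ := by
  classical
  refine ⟨fun v => decide ((v, true) ∈ L), fun C hC => ?_⟩
  obtain ⟨⟨v, b⟩, hl, hL⟩ := h.2.2 C hC
  refine ⟨_, hl, ?_⟩
  cases b with
  | true => simpa using hL
  | false => simpa [neg] using h.1 _ hL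

theorem Reachable.of_run {run : ℕ → Config V} (h0 : run 0 = initial Φs Φm)
    (hr : ∀ n, Step I (vars Φs ∪ I) (vars Φm ∪ I) (run n) (run (n + 1))) (n : ℕ) :
    Reachable Φs Φm I (run n) := by
  induction n with
  | zero => rw [h0]; exact .refl
  | succ n ih => exact ih.tail (hr n)

end Main
end SpecSMS

theorem mainTheorem1 {V : Type*} [DecidableEq V] (Φs Φm : SpecSMS.Formula V) (I : Finset V)
    (hI : SpecSMS.vars Φs ∩ SpecSMS.vars Φm ⊆ I) :
    -- every run is finite
    (¬ ∃ run : ℕ → SpecSMS.Config V, run 0 = SpecSMS.initial Φs Φm ∧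
      ∀ n, SpecSMS.Step I (SpecSMS.vars Φs ∪ I) (SpecSMS.vars Φm ∪ I) (run n) (run (n + 1))) ∧
    -- and can only stop in a final state
    (∀ c, SpecSMS.Reachable Φs Φm I c →
      (∀ c', ¬ SpecSMS.Step I (SpecSMS.vars Φs ∪ I) (SpecSMS.vars Φm ∪ I) c c') → c.IsFinal) ∧
    -- if it reaches `⟨F, F⟩`, the join of the trails is a satisfying assignment
    (∀ s m, SpecSMS.Reachable Φs Φm I (.run s m) → s.mode = .F → m.mode = .F →
      SpecSMS.Satisfiable (Φs ∪ Φm) ∧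
        SpecSMS.IsSatisfyingAssignment (SpecSMS.lits s.trail ∪ SpecSMS.lits m.trail) (Φs ∪ Φm)) ∧
    -- if it reaches `unsat`, the formula is unsatisfiable
    (SpecSMS.Reachable Φs Φm I .unsat → ¬ SpecSMS.Satisfiable (Φs ∪ Φm)) := by
  refine ⟨?_, fun c hc hst => ?_, fun s m h hs hm => ?_, fun h => h.inv⟩
  · rintro ⟨run, h0, hr⟩
    have hdec : ∀ n, SpecSMS.energy (SpecSMS.vars Φs ∪ I) (SpecSMS.vars Φm ∪ I) (run (n + 1)) <
        SpecSMS.energy (SpecSMS.vars Φs ∪ I) (SpecSMS.vars Φm ∪ I) (run n) := fun n =>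
      (hr n).energy_lt Finset.subset_union_right Finset.subset_union_right
        (SpecSMS.Reachable.of_run h0 hr n).inv
    -- An infinite run would give an infinite descent in a lexicographic product of copies of `ℕ`.
    exact not_strictAnti_of_wellFoundedLT
      (fun n => SpecSMS.energy (SpecSMS.vars Φs ∪ I) (SpecSMS.vars Φm ∪ I) (run n))
      (strictAnti_nat_of_succ_lt hdec)
  · exact (hc.inv.isFinal_or_step Finset.subset_union_right).resolve_right
      fun ⟨c', hc'⟩ => hst c' hc'
  · have hsat := SpecSMS.RunInv.isSatisfyingAssignment hI h.inv hs hm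
    exact ⟨hsat.satisfiable, hsat⟩
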